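/- For $M\in\mathbb N$ let $\mathcal Q_M$ be the set of rationals in $[-M,M]$ with denominator at most $M$; every pair of rationals lies in $\mathcal Q_M$ for some $M$. Write $\hat\mu(\xi)=\int e^{-2\pi i x\xi}\,d\mu(x)$. (i) Let $M\in\mathbb N$, let $\Lambda,K,c_0\in\mathbb R$ and let $\omega:\mathbb N\to\mathbb R$ satisfy $\omega(l)\to0$ as $l\to\infty$. There is $\epsilon_0=\epsilon_0(M,\Lambda,K,c_0,\omega)>0$ with the following property. Let $A\subset[0,1]$ be compact with Hausdorff dimension $s=\dim_H(A)>1-\epsilon_0$ and $c_0>\frac{1-s}{4}$, and suppose that $A$ supports a Borel probability measure $\mu$ which is Frostman, in that for some $\beta>1-\epsilon_0$ $$\mu(I)\le\Lambda\,|I|^{\beta}\qquad\text{for every compact interval } I \text{ of positive length},$$ and quantitatively Fourier uniform, in that $$\big\|\hat\mu\cdot\mathbf 1_{2^{l-1}\le|\xi|\le2^{l+1}}\big\|_{L^4(\mathbb R)}\le K\,2^{(\omega(l)-c_0)l}\qquad\text{for every integer } l\ge1.$$ Then for all $\theta_1,\theta_2\in\mathcal Q_M$ there are $x\in\mathbb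 R$ and $t\ne0$ with $\{x,\,x-\theta_1t,\,x-\theta_2t\}\subset A$. (ii) In particular, let $M\in\mathbb N$, $\Lambda,K\in\mathbb R$ and $\alpha>1/2$. There is $\epsilon_0=\epsilon_0(M,\Lambda,K,\alpha)>0$ such that the same conclusion holds for every compact $A\subset[0,1]$ with $\dim_H(A)>1-\epsilon_0$ that supports a Borel probability measure $\mu$ with $\mu(I)\le\Lambda|I|^\beta$ for every compact interval $I$ of positive length, for some $\beta>1-\epsilon_0$, and with $|\hat\mu(\xi)|\le K(1+|\xi|)^{-\alpha/2}$ for all $\xi\in\mathbb R$ (so that $A$ has Fourier dimension at least $\alpha>1/2$). -/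

import Mathlib

open MeasureTheory Filter Topology
open scoped NNReal ENNReal

noncomputable section

namespace Roth

/-- The Fourier transform `μ̂(ξ) = ∫ e^{-2πi x ξ} dμ(x)` of a finite Borel measure on `ℝ`. -/
def fourierTransform (μ : Measure ℝ) (ξ : ℝ) : ℂ :=
  ∫ x : ℝ, Complex.exp (-(2 * Real.pi * x * ξ : ℝ) * Complex.I) ∂μ

/-- `μ ∈ Pr(A)`: a Borel probability measure that lives on `A`. -/
def IsProbabilityOn (μ : Measure ℝ) (A : Set ℝ) : Prop :=
  IsProbabilityMeasure μ ∧ μ Aᶜ = 0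

/-- The Frostman condition `μ(I) ≤ Λ |I| ^ β` for all intervals `I` of positive length. -/
def IsFrostman (μ : Measure ℝ) (Λ β : ℝ) : Prop :=
  ∀ a b : ℝ, a < b → μ (Set.Icc a b) ≤ ENNReal.ofReal (Λ * (b - a) ^ β)

/-- The dyadic annulus `2 ^ (l - 1) ≤ |ξ| ≤ 2 ^ (l + 1)`. -/
def annulus (l : ℕ) : Set ℝ :=
  {ξ : ℝ | (2 : ℝ) ^ ((l : ℤ) - 1) ≤ |ξ| ∧ |ξ| ≤ (2 : ℝ) ^ ((l : ℤ) + 1)}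

/-- Quantitative Fourier uniformity: `‖μ̂ 1_{annulus l}‖₄ ≤ K 2 ^ ((ω(l) - c₀) l)` for `l ≥ 1`.
The sequence `ω` is the `o(1)` term; that it tends to `0` is required where this is used. -/
def IsFourierUniform (μ : Measure ℝ) (K : ℝ) (ω : ℕ → ℝ) (c₀ : ℝ) : Prop :=
  ∀ l : ℕ, 1 ≤ l →
    eLpNorm ((annulus l).indicator (fourierTransform μ)) 4 volume
      ≤ ENNReal.ofReal (K * (2 : ℝ) ^ ((ω l - c₀) * (l : ℝ)))

/-- Pointwise Fourier decay `|μ̂(ξ)| ≤ K (1 + |ξ|) ^ (-α / 2)`, as in the definition of the Fourier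
dimension: a set that carries such a probability measure has Fourier dimension at least `α`. -/
def HasFourierDecay (μ : Measure ℝ) (K α : ℝ) : Prop :=
  ∀ ξ : ℝ, ‖fourierTransform μ ξ‖ ≤ K * (1 + |ξ|) ^ (-α / 2)

/-- The rationals in `[-M, M]` with denominator at most `M`. -/
def rationalsOfHeight (M : ℕ) : Set ℚ :=
  {θ : ℚ | θ.den ≤ M ∧ |θ| ≤ (M : ℚ)}

/-- `A` contains a non-trivial generalized progression `{x, x - θ₁ t, x - θ₂ t}`, `t ≠ 0`. -/
def ContainsProgression (A : Set ℝ) (θ₁ θ₂ : ℚ) : Prop :=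
  ∃ x t : ℝ, t ≠ 0 ∧ ({x, x - (θ₁ : ℝ) * t, x - (θ₂ : ℝ) * t} : Set ℝ) ⊆ A

end Roth

end

noncomputable section

namespace Roth

open scoped FourierTransform Pointwise

/-! With `r = θ₂ / θ₁`, a nondegenerate progression is a triple `x, y, (1 - r) x + r y` with `x ≠ y`
and `r ≠ 0, 1`. The argument is by compactness. If no `ε₀` works, there are progression-free sets
with measures `μ n` whose Frostman exponents have lower bounds tending to 1. By Prokhorov's theorem
a subsequence converges weakly, and the limit has density at most `Λ`.

Approximate progressions are counted at scale `δ` with a tent kernel and the weight `2 - 2 cos (π (x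
- y))`, which removes the diagonal. Two bounds on this count collide.

Lower bound (`exists_pos_le_weightedForm`): an absolutely continuous measure dominates a multiple of
Lebesgue measure on a compact set of positive measure. Translates of that set by small amounts
overlap substantially, so the count stays above some `κ > 0` as `δ` tends to 0.

Upper bound (`exists_weightedForm_le`): on the frequency side the count integrates products of three
values of `μ̂`. The Frostman condition bounds `μ̂` in `L²` on dyadic annuli and uniformity bounds it
in `L⁴`; interpolation gives `L³` bounds decaying geometrically (`lintegral_annulus_pow_three_le`).
The frequency integrals therefore have uniformly small tails, and the count at scale `δ` is close to
its limit as the scale tends to 0, uniformly in `n`. Without progressions that limit is 0.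

At fixed `δ` the count is weakly continuous, so the two bounds contradict each other. Finitely many
pairs `(θ₁, θ₂)` then share one `ε₀`. Pointwise decay with `α > 1 / 2` is a case of uniformity with
`c₀ = (2 α - 1) / 4`. -/

/-! ### The tent function and its Fourier transform. -/

/-- The tent function `max (1 - |z|) 0`. -/
def tent (z : ℝ) : ℝ := max (1 - |z|) 0

/-- The Fourier transform of the tent function. -/
def sincSq (ξ : ℝ) : ℝ := Real.sinc (Real.pi * ξ) ^ 2

lemma tent_nonneg (z : ℝ) : 0 ≤ tent z := le_max_right _ _

lemma tent_le_one (z : ℝ) : tent z ≤ 1 :=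
  max_le (by linarith [abs_nonneg z]) zero_le_one

lemma tent_of_one_le {z : ℝ} (hz : 1 ≤ |z|) : tent z = 0 :=
  max_eq_right (by linarith)

lemma tent_of_le_one {z : ℝ} (hz : |z| ≤ 1) : tent z = 1 - |z| :=
  max_eq_left (by linarith)

lemma continuous_tent : Continuous tent := by unfold tent; fun_prop

lemma hasCompactSupport_tent : HasCompactSupport tent :=
  HasCompactSupport.intro (isCompact_Icc (a := (-1 : ℝ)) (b := 1)) fun x hx =>
    tent_of_one_le (by
      by_contra h
      exact hx ⟨by linarith [(abs_lt.1 (not_le.1 h)).1], (abs_lt.1 (not_le.1 h)).2.le⟩)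

lemma integrable_tent : Integrable tent :=
  continuous_tent.integrable_of_hasCompactSupport hasCompactSupport_tent

lemma sincSq_nonneg (ξ : ℝ) : 0 ≤ sincSq ξ := sq_nonneg _

lemma sincSq_le_one (ξ : ℝ) : sincSq ξ ≤ 1 :=
  (sq_le_one_iff_abs_le_one _).2 (Real.abs_sinc_le_one _)

lemma sincSq_zero : sincSq 0 = 1 := by simp [sincSq]

lemma continuous_sincSq : Continuous sincSq := by
  unfold sincSq
  exact (Real.continuous_sinc.comp (by fun_prop)).pow 2

/-- Jordan's inequality gives `sin (π x) ≥ 2 x` on `[0, 1 / 2]`, and `π ≤ 4`. This lets a smooth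
cutoff at scale `δ` dominate the indicator of `|δ ξ| ≤ 1 / 2`. -/
lemma quarter_le_sincSq {ξ : ℝ} (hξ : |ξ| ≤ 1 / 2) : 1 / 4 ≤ sincSq ξ := by
  rcases eq_or_ne ξ 0 with rfl | h0
  · norm_num [sincSq_zero]
  have hpi := Real.pi_pos
  have key : ∀ x : ℝ, 0 < x → x ≤ 1 / 2 → 1 / 2 ≤ Real.sinc (Real.pi * x) := by
    intro x hx hx2
    rw [Real.sinc_of_ne_zero (by positivity), le_div_iff₀ (by positivity)]
    have := Real.mul_le_sin (x := Real.pi * x) (by positivity) (by nlinarith)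
    have h2 : 2 / Real.pi * (Real.pi * x) = 2 * x := by field_simp
    rw [h2] at this
    nlinarith [Real.pi_le_four]
  have h : 1 / 2 ≤ Real.sinc (Real.pi * ξ) := by
    rcases lt_or_gt_of_ne h0 with h | h
    · have := key (-ξ) (by linarith) (by rw [abs_of_neg h] at hξ; exact hξ)
      rwa [mul_neg, Real.sinc_neg] at this
    · exact key ξ h (by rw [abs_of_pos h] at hξ; exact hξ)
  unfold sincSq
  nlinarith

lemma sincSq_le_inv (ξ : ℝ) : sincSq ξ ≤ 2 * (1 + ξ ^ 2)⁻¹ := by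
  have h1 := sincSq_le_one ξ
  rcases eq_or_ne ξ 0 with rfl | h0
  · norm_num [sincSq_zero]
  have h2 : sincSq ξ * ξ ^ 2 ≤ 1 := by
    unfold sincSq
    rw [Real.sinc_of_ne_zero (mul_ne_zero Real.pi_ne_zero h0)]
    have : (Real.sin (Real.pi * ξ) / (Real.pi * ξ)) ^ 2 * ξ ^ 2
        = Real.sin (Real.pi * ξ) ^ 2 / Real.pi ^ 2 := by
      have := Real.pi_ne_zero
      field_simp
    rw [this, div_le_one (by positivity)]
    nlinarith [Real.sin_sq_le_one (Real.pi * ξ), Real.pi_gt_three]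
  rw [← div_eq_mul_inv, le_div_iff₀ (by positivity)]
  nlinarith

lemma integrable_sincSq : Integrable sincSq := by
  refine (integrable_inv_one_add_sq.const_mul 2).mono' continuous_sincSq.aestronglyMeasurable ?_
  filter_upwards with ξ
  rw [Real.norm_of_nonneg (sincSq_nonneg ξ)]
  exact sincSq_le_inv ξ

lemma intervalIntegral_one_sub_mul_exp {c : ℂ} (hc : c ≠ 0) :
    ∫ x in (0 : ℝ)..1, (1 - x : ℂ) * Complex.exp (c * x)
      = Complex.exp c / c ^ 2 - 1 / c - 1 / c ^ 2 := by
  have hd : ∀ x : ℝ, HasDerivAt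
      (fun x : ℝ => (1 - x : ℂ) * (Complex.exp (c * x) / c) + Complex.exp (c * x) / c ^ 2)
      ((1 - x : ℂ) * Complex.exp (c * x)) x := by
    intro x
    have h1 : HasDerivAt (fun x : ℝ => Complex.exp (c * x)) (Complex.exp (c * x) * c) x := by
      have : HasDerivAt (fun x : ℝ => c * (x : ℂ)) (c * 1) x :=
        (Complex.ofRealCLM.hasDerivAt (x := x)).const_mul c
      simpa using this.cexp
    have h2 : HasDerivAt (fun x : ℝ => (1 - x : ℂ)) (-1) x := by
      simpa using (Complex.ofRealCLM.hasDerivAt (x := x)).const_sub (1 : ℂ)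
    have := (h2.mul (h1.div_const c)).add (h1.div_const (c ^ 2))
    refine this.congr_deriv ?_
    field_simp
    ring
  rw [intervalIntegral.integral_eq_sub_of_hasDerivAt (fun x _ => hd x)]
  · simp
    ring
  · apply Continuous.intervalIntegrable
    fun_prop

lemma integral_tent_mul_exp (c : ℂ) :
    ∫ x : ℝ, (tent x : ℂ) * Complex.exp (c * x)
      = (∫ x in (0 : ℝ)..1, (1 - x : ℂ) * Complex.exp (c * x))
        + ∫ x in (0 : ℝ)..1, (1 - x : ℂ) * Complex.exp (-c * x) := by
  have hcont : Continuous fun x : ℝ => (tent x : ℂ) * Complex.exp (c * x) := by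
    have := continuous_tent
    fun_prop
  have hsupp : Function.support (fun x : ℝ => (tent x : ℂ) * Complex.exp (c * x))
      ⊆ Set.Ioc (-1) 1 := by
    intro x hx
    by_contra h
    apply hx
    have : tent x = 0 := by
      refine tent_of_one_le ?_
      by_contra h'
      exact h ⟨(abs_lt.1 (not_le.1 h')).1, (abs_lt.1 (not_le.1 h')).2.le⟩
    simp [this]
  rw [← intervalIntegral.integral_eq_integral_of_support_subset hsupp,
    ← intervalIntegral.integral_add_adjacent_intervals (b := 0)
      (hcont.intervalIntegrable _ _) (hcont.intervalIntegrable _ _), add_comm]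
  congr 1
  · apply intervalIntegral.integral_congr
    intro x hx
    rw [Set.uIcc_of_le zero_le_one] at hx
    have : tent x = 1 - x := by
      rw [tent_of_le_one (by rw [abs_of_nonneg hx.1]; exact hx.2), abs_of_nonneg hx.1]
    simp [this]
  · have h := intervalIntegral.integral_comp_neg (a := 0) (b := 1)
      (fun x : ℝ => (tent x : ℂ) * Complex.exp (c * x))
    rw [neg_zero] at h
    rw [← h]
    apply intervalIntegral.integral_congr
    intro x hx
    rw [Set.uIcc_of_le zero_le_one] at hx
    have : tent (-x) = 1 - x := by
      rw [tent_of_le_one (by rw [abs_neg, abs_of_nonneg hx.1]; exact hx.2), abs_neg,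
        abs_of_nonneg hx.1]
    simp [this]

lemma fourier_tent {ξ : ℝ} (hξ : ξ ≠ 0) :
    𝓕 (fun x : ℝ => (tent x : ℂ)) ξ = (sincSq ξ : ℂ) := by
  rw [Real.fourier_real_eq_integral_exp_smul]
  have hpi := Real.pi_ne_zero
  have hpi' : (Real.pi : ℂ) ≠ 0 := by exact_mod_cast hpi
  have hξ' : (ξ : ℂ) ≠ 0 := by exact_mod_cast hξ
  have hc : ((-2 * Real.pi * ξ : ℝ) : ℂ) * Complex.I ≠ 0 := by
    simp [hpi, hξ]
  have h1 := integral_tent_mul_exp (((-2 * Real.pi * ξ : ℝ) : ℂ) * Complex.I)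
  rw [intervalIntegral_one_sub_mul_exp hc, intervalIntegral_one_sub_mul_exp (neg_ne_zero.2 hc)]
    at h1
  have h2 : ∫ v : ℝ, Complex.exp (((-2 * Real.pi * v * ξ : ℝ) : ℂ) * Complex.I) • (tent v : ℂ)
      = ∫ x : ℝ, (tent x : ℂ) * Complex.exp (((-2 * Real.pi * ξ : ℝ) : ℂ) * Complex.I * x) := by
    congr 1
    ext v
    rw [smul_eq_mul, mul_comm]
    congr 2
    push_cast
    ring
  rw [h2, h1, sincSq, Real.sinc_of_ne_zero (mul_ne_zero hpi hξ)]
  have h3 : Complex.exp (((-2 * Real.pi * ξ : ℝ) : ℂ) * Complex.I)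
      + Complex.exp (-(((-2 * Real.pi * ξ : ℝ) : ℂ) * Complex.I))
      = 2 - 4 * (Complex.sin (Real.pi * ξ)) ^ 2 := by
    have h4 := Complex.two_cos (((-2 * Real.pi * ξ : ℝ) : ℂ))
    rw [← neg_mul, ← h4]
    have h5 : (((-2 * Real.pi * ξ : ℝ) : ℂ)) = -(2 * (Real.pi * ξ : ℂ)) := by push_cast; ring
    rw [h5, Complex.cos_neg, Complex.cos_two_mul, Complex.cos_sq']
    ring
  set c := ((-2 * Real.pi * ξ : ℝ) : ℂ) * Complex.I with hcdef
  have h6 : Complex.exp c / c ^ 2 - 1 / c - 1 / c ^ 2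
      + (Complex.exp (-c) / (-c) ^ 2 - 1 / (-c) - 1 / (-c) ^ 2)
      = (Complex.exp c + Complex.exp (-c) - 2) / c ^ 2 := by
    field_simp
    ring
  have h7 : c ^ 2 = -(4 * (Real.pi * ξ) ^ 2 : ℂ) := by
    rw [hcdef, mul_pow, Complex.I_sq]
    push_cast
    ring
  rw [h6, h3, h7]
  push_cast
  field_simp
  ring

lemma fourier_tent_ae :
    𝓕 (fun x : ℝ => (tent x : ℂ)) =ᵐ[volume] fun ξ => (sincSq ξ : ℂ) := by
  have : ∀ᵐ ξ : ℝ, ξ ≠ 0 := by simp [ae_iff]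
  filter_upwards [this] with ξ hξ using fourier_tent hξ

/-- Fourier inversion: the tent is continuous and both it and its transform are integrable. Knowing
the transform off the null set `{0}` is enough. -/
lemma tent_eq_integral (z : ℝ) :
    (tent z : ℂ) = ∫ ξ : ℝ, (sincSq ξ : ℂ) *
      Complex.exp ((2 * Real.pi * z * ξ : ℝ) * Complex.I) := by
  have h1 : Integrable (fun x : ℝ => (tent x : ℂ)) := integrable_tent.ofReal
  have h2 : Integrable (𝓕 (fun x : ℝ => (tent x : ℂ))) :=
    (integrable_congr fourier_tent_ae).2 integrable_sincSq.ofReal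
  have h3 : Continuous (fun x : ℝ => (tent x : ℂ)) := by
    have := continuous_tent
    fun_prop
  have h4 := congrFun (h3.fourierInv_fourier_eq h1 h2) z
  rw [← h4, Real.fourierInv_eq']
  apply integral_congr_ae
  filter_upwards [fourier_tent_ae] with ξ hξ
  rw [hξ, smul_eq_mul, mul_comm]
  congr 3
  simp
  ring

/-- The tent function of width `δ` and integral one. -/
def tentKernel (δ z : ℝ) : ℝ := δ⁻¹ * tent (δ⁻¹ * z)

lemma tentKernel_nonneg {δ : ℝ} (hδ : 0 < δ) (z : ℝ) : 0 ≤ tentKernel δ z :=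
  mul_nonneg (inv_nonneg.2 hδ.le) (tent_nonneg _)

lemma tentKernel_le {δ : ℝ} (hδ : 0 < δ) (z : ℝ) : tentKernel δ z ≤ δ⁻¹ :=
  mul_le_of_le_one_right (inv_nonneg.2 hδ.le) (tent_le_one _)

lemma tentKernel_of_le {δ z : ℝ} (hδ : 0 < δ) (hz : δ ≤ |z|) : tentKernel δ z = 0 := by
  rw [tentKernel, tent_of_one_le, mul_zero]
  rw [abs_mul, abs_of_pos (inv_pos.2 hδ), inv_mul_eq_div, le_div_iff₀ hδ]
  linarith

lemma continuous_tentKernel (δ : ℝ) : Continuous (tentKernel δ) := by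
  have := continuous_tent
  unfold tentKernel
  fun_prop

lemma integrable_sincSq_mul {δ : ℝ} (hδ : 0 < δ) : Integrable fun ξ => sincSq (δ * ξ) :=
  integrable_sincSq.comp_mul_left' hδ.ne'

lemma tentKernel_eq_integral {δ : ℝ} (hδ : 0 < δ) (z : ℝ) :
    (tentKernel δ z : ℂ) = ∫ ξ : ℝ, (sincSq (δ * ξ) : ℂ) *
      Complex.exp ((2 * Real.pi * z * ξ : ℝ) * Complex.I) := by
  have h := Measure.integral_comp_mul_left (fun ξ : ℝ => (sincSq ξ : ℂ) *
      Complex.exp ((2 * Real.pi * (δ⁻¹ * z) * ξ : ℝ) * Complex.I)) δ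
  rw [← tent_eq_integral, abs_of_pos (inv_pos.2 hδ)] at h
  rw [tentKernel, Complex.ofReal_mul, ← Complex.real_smul, ← h]
  congr 1
  ext ξ
  congr 4
  field_simp

/-! ### Characters and Fourier transforms of measures. -/

/-- The character `t ↦ e^{2πit}`. -/
def echar (t : ℝ) : ℂ := Complex.exp ((2 * Real.pi * t : ℝ) * Complex.I)

lemma norm_echar (t : ℝ) : ‖echar t‖ = 1 := Complex.norm_exp_ofReal_mul_I _

lemma echar_zero : echar 0 = 1 := by simp [echar]

lemma echar_add (s t : ℝ) : echar (s + t) = echar s * echar t := by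
  unfold echar
  rw [← Complex.exp_add]
  congr 1
  push_cast
  ring

lemma continuous_echar : Continuous echar := by unfold echar; fun_prop

lemma echar_add_echar_neg (t : ℝ) :
    echar t + echar (-t) = (2 * Real.cos (2 * Real.pi * t) : ℝ) := by
  have h := Complex.two_cos ((2 * Real.pi * t : ℝ) : ℂ)
  unfold echar
  push_cast at h ⊢
  rw [h]
  congr 2
  ring

lemma fourierTransform_eq_echar (μ : Measure ℝ) (ξ : ℝ) :
    fourierTransform μ ξ = ∫ x, echar (-(x * ξ)) ∂μ := by
  unfold fourierTransform echar
  congr 1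
  ext x
  congr 1
  push_cast
  ring

lemma fourierTransform_eq_charFun (μ : Measure ℝ) (ξ : ℝ) :
    fourierTransform μ ξ = charFun μ (-(2 * Real.pi * ξ)) := by
  rw [charFun_apply_real]
  unfold fourierTransform
  congr 1
  ext x
  congr 1
  push_cast
  ring

lemma norm_fourierTransform_le_one (μ : Measure ℝ) [IsProbabilityMeasure μ] (ξ : ℝ) :
    ‖fourierTransform μ ξ‖ ≤ 1 := by
  rw [fourierTransform_eq_charFun]
  exact norm_charFun_le_one _

lemma measurable_fourierTransform (μ : Measure ℝ) [IsFiniteMeasure μ] :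
    Measurable (fourierTransform μ) := by
  have : fourierTransform μ = fun ξ => charFun μ (-(2 * Real.pi * ξ)) :=
    funext (fourierTransform_eq_charFun μ)
  rw [this]
  exact measurable_charFun.comp (by fun_prop)

lemma fourierTransform_neg (μ : Measure ℝ) (ξ : ℝ) :
    fourierTransform μ (-ξ) = starRingEnd ℂ (fourierTransform μ ξ) := by
  rw [fourierTransform_eq_charFun, fourierTransform_eq_charFun, ← charFun_neg]
  congr 1
  ring

/-- A tent kernel integrated against a finite measure, written on the frequency side. -/
lemma integral_tentKernel_mul_echar {X : Type*} [MeasurableSpace X] (P : Measure X)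
    [IsFiniteMeasure P] {a b : X → ℝ} (ha : Measurable a) (hb : Measurable b) {δ : ℝ}
    (hδ : 0 < δ) :
    ∫ p, (tentKernel δ (a p) : ℂ) * echar (b p) ∂P
      = ∫ ξ : ℝ, (sincSq (δ * ξ) : ℂ) * ∫ p, echar (a p * ξ + b p) ∂P := by
  have h1 : ∀ p, (tentKernel δ (a p) : ℂ) * echar (b p)
      = ∫ ξ : ℝ, (sincSq (δ * ξ) : ℂ) * echar (a p * ξ + b p) := by
    intro p
    rw [tentKernel_eq_integral hδ, ← integral_mul_const]
    congr 1
    ext ξ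
    rw [echar_add, ← mul_assoc]
    unfold echar
    rw [mul_assoc (2 * Real.pi)]
  simp_rw [h1]
  rw [integral_integral_swap]
  · simp_rw [integral_const_mul]
  · have hint : Integrable (fun q : X × ℝ => (1 : ℝ) * sincSq (δ * q.2)) (P.prod volume) :=
      Integrable.mul_prod (integrable_const (1 : ℝ)) (integrable_sincSq_mul hδ)
    refine hint.mono' ?_ ?_
    · apply Measurable.aestronglyMeasurable
      have h2 : Measurable sincSq := continuous_sincSq.measurable
      have h3 : Measurable echar := continuous_echar.measurable
      simp only [Function.uncurry_def]
      fun_prop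
    · filter_upwards with q
      simp [Function.uncurry_def, norm_echar, abs_of_nonneg (sincSq_nonneg _)]

/-! ### The trilinear form in physical and frequency space. -/

/-- The integrand on the frequency side of the trilinear form with modulation `u`. -/
def freqForm (r u : ℝ) (μ : Measure ℝ) (ξ : ℝ) : ℂ :=
  fourierTransform μ (-((1 - r) * ξ + u)) *
    (fourierTransform μ (-(r * ξ - u)) * fourierTransform μ ξ)

/-- The phase is linear in the three coordinates, so the integral factors. -/
lemma integral_echar_prod (r u : ℝ) (μ : Measure ℝ) [IsFiniteMeasure μ] (ξ : ℝ) :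
    ∫ p, echar (((1 - r) * p.1 + r * p.2.1 - p.2.2) * ξ + u * (p.1 - p.2.1))
      ∂(μ.prod (μ.prod μ)) = freqForm r u μ ξ := by
  have h : ∀ p : ℝ × ℝ × ℝ,
      echar (((1 - r) * p.1 + r * p.2.1 - p.2.2) * ξ + u * (p.1 - p.2.1))
      = echar (-(p.1 * -((1 - r) * ξ + u))) *
        (fun q : ℝ × ℝ => echar (-(q.1 * -(r * ξ - u))) * echar (-(q.2 * ξ))) p.2 := by
    intro p
    simp only [← echar_add]
    congr 1
    ring
  rw [integral_congr_ae (ae_of_all _ h),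
    integral_prod_mul (fun x => echar (-(x * -((1 - r) * ξ + u))))
      (fun q : ℝ × ℝ => echar (-(q.1 * -(r * ξ - u))) * echar (-(q.2 * ξ))),
    integral_prod_mul (fun x => echar (-(x * -(r * ξ - u)))) (fun x => echar (-(x * ξ)))]
  simp_rw [freqForm, fourierTransform_eq_echar]

/-- The weighted count of approximate progressions `x, y, (1 - r) x + r y`; the weight vanishes
on the diagonal `x = y`. -/
def weightedForm (r δ : ℝ) (μ : Measure ℝ) : ℝ :=
  ∫ p, tentKernel δ ((1 - r) * p.1 + r * p.2.1 - p.2.2) *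
    (2 - 2 * Real.cos (Real.pi * (p.1 - p.2.1))) ∂(μ.prod (μ.prod μ))

/-- The frequency side of `weightedForm`. -/
def weightedFreq (r : ℝ) (μ : Measure ℝ) (ξ : ℝ) : ℂ :=
  2 * freqForm r 0 μ ξ - freqForm r (1 / 2) μ ξ - freqForm r (-(1 / 2)) μ ξ

lemma norm_freqForm_le_one (r u : ℝ) (μ : Measure ℝ) [IsProbabilityMeasure μ] (ξ : ℝ) :
    ‖freqForm r u μ ξ‖ ≤ 1 := by
  unfold freqForm
  rw [norm_mul, norm_mul]
  exact mul_le_one₀ (norm_fourierTransform_le_one _ _) (by positivity)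
    (mul_le_one₀ (norm_fourierTransform_le_one _ _) (by positivity)
      (norm_fourierTransform_le_one _ _))

lemma measurable_freqForm (r u : ℝ) (μ : Measure ℝ) [IsFiniteMeasure μ] :
    Measurable (freqForm r u μ) := by
  have := measurable_fourierTransform μ
  unfold freqForm
  fun_prop

lemma measurable_weightedFreq (r : ℝ) (μ : Measure ℝ) [IsFiniteMeasure μ] :
    Measurable (weightedFreq r μ) := by
  have h0 := measurable_freqForm r 0 μ
  have h1 := measurable_freqForm r (1 / 2) μ
  have h2 := measurable_freqForm r (-(1 / 2)) μ
  unfold weightedFreq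
  fun_prop

lemma norm_weightedFreq_le (r : ℝ) (μ : Measure ℝ) (ξ : ℝ) :
    ‖weightedFreq r μ ξ‖ ≤ 2 * ‖freqForm r 0 μ ξ‖ + ‖freqForm r (1 / 2) μ ξ‖
      + ‖freqForm r (-(1 / 2)) μ ξ‖ := by
  unfold weightedFreq
  refine (norm_sub_le _ _).trans (add_le_add_left ((norm_sub_le _ _).trans ?_) _)
  simp

lemma norm_weightedFreq_le_four (r : ℝ) (μ : Measure ℝ) [IsProbabilityMeasure μ] (ξ : ℝ) :
    ‖weightedFreq r μ ξ‖ ≤ 4 := by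
  have := norm_weightedFreq_le r μ ξ
  linarith [norm_freqForm_le_one r 0 μ ξ, norm_freqForm_le_one r (1 / 2) μ ξ,
    norm_freqForm_le_one r (-(1 / 2)) μ ξ]

lemma integrable_tentKernel_mul_echar {X : Type*} [MeasurableSpace X] (P : Measure X)
    [IsFiniteMeasure P] {a b : X → ℝ} (ha : Measurable a) (hb : Measurable b) {δ : ℝ}
    (hδ : 0 < δ) : Integrable (fun p => (tentKernel δ (a p) : ℂ) * echar (b p)) P := by
  refine (integrable_const δ⁻¹).mono' ?_ ?_
  · apply Measurable.aestronglyMeasurable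
    have h2 : Measurable (tentKernel δ) := (continuous_tentKernel δ).measurable
    have h3 : Measurable echar := continuous_echar.measurable
    fun_prop
  · filter_upwards with q
    simpa [norm_echar, abs_of_nonneg (tentKernel_nonneg hδ _)] using tentKernel_le hδ _

lemma integral_tentKernel_eq (r u : ℝ) {δ : ℝ} (hδ : 0 < δ) (μ : Measure ℝ)
    [IsFiniteMeasure μ] :
    ∫ p, (tentKernel δ ((1 - r) * p.1 + r * p.2.1 - p.2.2) : ℂ) * echar (u * (p.1 - p.2.1))
      ∂(μ.prod (μ.prod μ)) = ∫ ξ : ℝ, (sincSq (δ * ξ) : ℂ) * freqForm r u μ ξ := by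
  rw [integral_tentKernel_mul_echar _ (by fun_prop) (by fun_prop) hδ]
  simp_rw [integral_echar_prod]

lemma integrable_sincSq_mul_freqForm (r u : ℝ) {δ : ℝ} (hδ : 0 < δ) (μ : Measure ℝ)
    [IsProbabilityMeasure μ] :
    Integrable fun ξ : ℝ => (sincSq (δ * ξ) : ℂ) * freqForm r u μ ξ :=
  (integrable_sincSq_mul hδ).ofReal.mul_bdd (c := 1)
    (measurable_freqForm r u μ).aestronglyMeasurable
    (ae_of_all _ fun ξ => norm_freqForm_le_one r u μ ξ)

lemma integral_two_mul_sub_sub {X : Type*} [MeasurableSpace X] {P : Measure X} {f g h : X → ℂ}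
    (hf : Integrable f P) (hg : Integrable g P) (hh : Integrable h P) :
    ∫ x, (2 * f x - g x - h x) ∂P = 2 * ∫ x, f x ∂P - ∫ x, g x ∂P - ∫ x, h x ∂P := by
  have h2 : Integrable (fun x => 2 * f x) P := hf.const_mul 2
  have h3 : Integrable (fun x => 2 * f x - g x) P := h2.sub hg
  rw [integral_sub h3 hh, integral_sub h2 hg, integral_const_mul]

/-- The weight is `2 - e(z / 2) - e(-z / 2)` with `z = x - y`. Each character only shifts the
arguments of two of the three transforms, so the diagonal weight costs nothing on the frequency
side. -/
lemma weightedForm_eq (r : ℝ) {δ : ℝ} (hδ : 0 < δ) (μ : Measure ℝ) [IsProbabilityMeasure μ] :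
    (weightedForm r δ μ : ℂ) = ∫ ξ : ℝ, (sincSq (δ * ξ) : ℂ) * weightedFreq r μ ξ := by
  have hR : ∀ ξ : ℝ, (sincSq (δ * ξ) : ℂ) * weightedFreq r μ ξ
      = 2 * ((sincSq (δ * ξ) : ℂ) * freqForm r 0 μ ξ)
        - (sincSq (δ * ξ) : ℂ) * freqForm r (1 / 2) μ ξ
        - (sincSq (δ * ξ) : ℂ) * freqForm r (-(1 / 2)) μ ξ := by
    intro ξ
    unfold weightedFreq
    ring
  have hL : ∀ p : ℝ × ℝ × ℝ, ((tentKernel δ ((1 - r) * p.1 + r * p.2.1 - p.2.2) *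
      (2 - 2 * Real.cos (Real.pi * (p.1 - p.2.1))) : ℝ) : ℂ)
      = 2 * ((tentKernel δ ((1 - r) * p.1 + r * p.2.1 - p.2.2) : ℂ) * echar (0 * (p.1 - p.2.1)))
        - (tentKernel δ ((1 - r) * p.1 + r * p.2.1 - p.2.2) : ℂ) * echar ((1 / 2) * (p.1 - p.2.1))
        - (tentKernel δ ((1 - r) * p.1 + r * p.2.1 - p.2.2) : ℂ)
          * echar (-(1 / 2) * (p.1 - p.2.1)) := by
    intro p
    have h := echar_add_echar_neg ((1 / 2) * (p.1 - p.2.1))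
    rw [zero_mul, echar_zero, neg_mul]
    have h2 : 2 * Real.pi * (1 / 2 * (p.1 - p.2.1)) = Real.pi * (p.1 - p.2.1) := by ring
    rw [h2] at h
    rw [sub_sub, ← mul_add, h]
    push_cast
    ring
  have i0 := fun u => integrable_sincSq_mul_freqForm r u hδ μ
  have j0 := fun u : ℝ => integrable_tentKernel_mul_echar (μ.prod (μ.prod μ))
    (a := fun p => (1 - r) * p.1 + r * p.2.1 - p.2.2) (b := fun p => u * (p.1 - p.2.1))
    (by fun_prop) (by fun_prop) hδ
  unfold weightedForm
  rw [← integral_complex_ofReal]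
  simp_rw [hR, hL]
  rw [integral_two_mul_sub_sub (j0 0) (j0 (1 / 2)) (j0 (-(1 / 2))),
    integral_two_mul_sub_sub (i0 0) (i0 (1 / 2)) (i0 (-(1 / 2)))]
  simp_rw [integral_tentKernel_eq _ _ hδ]

/-! ### Lower bound for absolutely continuous measures. -/

/-- The density exceeds some `1 / (n + 1)` on a set of positive measure; inner regularity supplies a
compact subset. -/
lemma exists_isCompact_smul_restrict_le {μ : Measure ℝ} [IsFiniteMeasure μ] (h0 : μ ≠ 0)
    (hμ : μ ≪ volume) :
    ∃ E : Set ℝ, IsCompact E ∧ 0 < volume E ∧ ∃ c : ℝ≥0∞, 0 < c ∧ c • volume.restrict E ≤ μ := by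
  set f := μ.rnDeriv volume with hf
  have hfm : Measurable f := Measure.measurable_rnDeriv _ _
  have hμf : volume.withDensity f = μ := Measure.withDensity_rnDeriv_eq _ _ hμ
  obtain ⟨n, hn⟩ : ∃ n : ℕ, 0 < volume {x | ((n : ℝ≥0∞) + 1)⁻¹ < f x} := by
    by_contra! hcon
    apply h0
    rw [← hμf, withDensity_eq_zero_iff hfm.aemeasurable]
    have h1 : ∀ᵐ x, ∀ n : ℕ, ¬ ((n : ℝ≥0∞) + 1)⁻¹ < f x := by
      rw [ae_all_iff]
      intro n
      rw [ae_iff]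
      simpa only [not_not, nonpos_iff_eq_zero] using hcon n
    filter_upwards [h1] with x hx
    by_contra hne
    obtain ⟨n, hn⟩ := ENNReal.exists_inv_nat_lt hne
    exact hx n (lt_of_le_of_lt (ENNReal.inv_le_inv.2 le_self_add) hn)
  obtain ⟨E, hES, hE, hEpos⟩ :=
    (measurableSet_lt measurable_const hfm).exists_lt_isCompact hn
  refine ⟨E, hE, hEpos, ((n : ℝ≥0∞) + 1)⁻¹, by simp, ?_⟩
  rw [Measure.le_iff]
  intro s hs
  rw [Measure.smul_apply, Measure.restrict_apply hs, smul_eq_mul, ← hμf, withDensity_apply _ hs,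
    ← setLIntegral_const]
  calc ∫⁻ _ in s ∩ E, ((n : ℝ≥0∞) + 1)⁻¹ ≤ ∫⁻ x in s ∩ E, f x :=
        setLIntegral_mono hfm fun x hx => le_of_lt (hES hx.2)
    _ ≤ ∫⁻ x in s, f x := lintegral_mono_set Set.inter_subset_left

/-- The measure of `(s + E) \ E` tends to 0 with `s` for compact `E`, so each of the two small
translations loses at most a quarter of `E`. -/
lemma exists_half_measure_le_inter_translates {E : Set ℝ} (hE : IsCompact E)
    (hpos : 0 < volume E) :
    ∃ η > 0, ∀ s t : ℝ, |s| < η → |t| < η →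
      volume E / 2 ≤ volume {x | x ∈ E ∧ x + s ∈ E ∧ x + t ∈ E} := by
  have hfin : volume E ≠ ⊤ := hE.measure_lt_top.ne
  have hT := tendsto_measure_vadd_sdiff_isCompact_isClosed (μ := (volume : Measure ℝ)) hE
    hE.isClosed
  have hev := hT.eventually_lt_const (u := volume E / 2 / 2)
    (ENNReal.div_pos (ENNReal.div_pos hpos.ne' (by norm_num)).ne' (by norm_num))
  obtain ⟨η, hη, hball⟩ := Metric.eventually_nhds_iff.1 hev
  have key : ∀ s : ℝ, |s| < η → volume {x | x ∈ E ∧ x + s ∉ E} ≤ volume E / 2 / 2 := by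
    intro s hs
    have h1 := hball (y := s) (by simpa using hs)
    have h2 : {x | x ∈ E ∧ x + s ∉ E} = (fun x => x + s) ⁻¹' ((s +ᵥ E) \ E) := by
      ext x
      simp only [Set.mem_ofPred_eq, Set.mem_preimage, Set.mem_sdiff,
        Set.mem_vadd_set_iff_neg_vadd_mem, vadd_eq_add]
      rw [show -s + (x + s) = x by ring]
    rw [h2, measure_preimage_add_right]
    exact h1.le
  refine ⟨η, hη, fun s t hs ht => ?_⟩
  have hsub : E ⊆ {x | x ∈ E ∧ x + s ∈ E ∧ x + t ∈ E} ∪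
      ({x | x ∈ E ∧ x + s ∉ E} ∪ {x | x ∈ E ∧ x + t ∉ E}) := by
    intro x hx
    by_cases h1 : x + s ∈ E <;> by_cases h2 : x + t ∈ E <;> simp [hx, h1, h2]
  have h3 : volume E ≤ volume {x | x ∈ E ∧ x + s ∈ E ∧ x + t ∈ E} + volume E / 2 := by
    refine (measure_mono hsub).trans ((measure_union_le _ _).trans ?_)
    gcongr
    refine (measure_union_le _ _).trans ((add_le_add (key s hs) (key t ht)).trans_eq ?_)
    exact ENNReal.add_halves _
  have h4 : volume E / 2 + volume E / 2 ≤ volume {x | x ∈ E ∧ x + s ∈ E ∧ x + t ∈ E}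
      + volume E / 2 := by rwa [ENNReal.add_halves]
  exact (ENNReal.add_le_add_iff_right (ENNReal.div_ne_top hfin (by norm_num))).1 h4

lemma half_le_lintegral_tentKernel {δ : ℝ} (hδ : 0 < δ) :
    1 / 2 ≤ ∫⁻ v, ENNReal.ofReal (tentKernel δ v) := by
  calc (1 / 2 : ℝ≥0∞) = ENNReal.ofReal ((2 * δ)⁻¹) * volume (Set.Icc (-(δ / 2)) (δ / 2)) := by
        rw [Real.volume_Icc, ← ENNReal.ofReal_mul (by positivity)]
        rw [show (2 * δ)⁻¹ * (δ / 2 - -(δ / 2)) = 1 / 2 by field_simp; ring]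
        rw [ENNReal.ofReal_div_of_pos (by norm_num)]
        simp
    _ = ∫⁻ _ in Set.Icc (-(δ / 2)) (δ / 2), ENNReal.ofReal ((2 * δ)⁻¹) := by
        rw [setLIntegral_const]
    _ ≤ ∫⁻ v in Set.Icc (-(δ / 2)) (δ / 2), ENNReal.ofReal (tentKernel δ v) := by
        refine setLIntegral_mono
          (ENNReal.measurable_ofReal.comp (continuous_tentKernel δ).measurable) fun v hv => ?_
        apply ENNReal.ofReal_le_ofReal
        have h1 : |δ⁻¹ * v| ≤ 1 / 2 := by
          rw [abs_mul, abs_of_pos (inv_pos.2 hδ), inv_mul_eq_div, div_le_iff₀ hδ]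
          have := abs_le.2 hv
          linarith
        rw [tentKernel, tent_of_le_one (by linarith), mul_inv, mul_comm]
        gcongr
        norm_num at h1 ⊢
        linarith
    _ ≤ ∫⁻ v, ENNReal.ofReal (tentKernel δ v) := setLIntegral_le_lintegral _ _

lemma weight_nonneg (z : ℝ) : 0 ≤ 2 - 2 * Real.cos (Real.pi * z) := by
  linarith [Real.cos_le_one (Real.pi * z)]

lemma weight_pos {z : ℝ} (h0 : 0 < z) (h1 : z < 1) : 0 < 2 - 2 * Real.cos (Real.pi * z) := by
  have : Real.cos (Real.pi * z) < Real.cos 0 :=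
    Real.cos_lt_cos_of_nonneg_of_le_pi le_rfl (by nlinarith [Real.pi_pos])
      (by have := Real.pi_pos; positivity)
  rw [Real.cos_zero] at this
  linarith

/-- Substitute `s = x - y` and `v = (1 - r) x + r y - w`, so that `y = x - s` and `w = x - r s - v`,
then integrate over `x` first. -/
lemma lintegral_triple_change_variables {E : Set ℝ} (hE : MeasurableSet E) {F : ℝ → ℝ → ℝ≥0∞}
    (hF : Measurable (Function.uncurry F)) (r : ℝ) :
    ∫⁻ x in E, ∫⁻ y in E, ∫⁻ w in E, F (x - y) ((1 - r) * x + r * y - w)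
      = ∫⁻ s, ∫⁻ v, F s v * volume {x | x ∈ E ∧ x + (-s) ∈ E ∧ x + (-(r * s) - v) ∈ E} := by
  set I : ℝ → ℝ≥0∞ := E.indicator 1 with hI
  have hIm : Measurable I := measurable_one.indicator hE
  have hset : ∀ f : ℝ → ℝ≥0∞, ∫⁻ x in E, f x = ∫⁻ x, I x * f x := by
    intro f
    rw [← lintegral_indicator hE]
    congr 1
    ext x
    by_cases hx : x ∈ E <;> simp [hI, hx]
  have hsub : ∀ (a : ℝ) (f : ℝ → ℝ≥0∞), ∫⁻ y, f y = ∫⁻ s, f (a - s) := fun a f =>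
    (lintegral_sub_left_eq_self f a).symm
  have h1 : ∀ x : ℝ, (∫⁻ y in E, ∫⁻ w in E, F (x - y) ((1 - r) * x + r * y - w))
      = ∫⁻ s, ∫⁻ v, I (x - s) * (I (x - r * s - v) * F s v) := by
    intro x
    rw [hset, hsub x]
    refine lintegral_congr fun s => ?_
    rw [hset, hsub (x - r * s), ← lintegral_const_mul]
    · refine lintegral_congr fun v => ?_
      congr 3 <;> ring
    · have : Measurable fun v => F (x - (x - s)) v := hF.comp measurable_prodMk_left
      fun_prop
  rw [hset]
  simp_rw [h1]
  have hm : Measurable fun q : ℝ × ℝ × ℝ =>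
      I q.1 * (I (q.1 - q.2.1) * (I (q.1 - r * q.2.1 - q.2.2) * F q.2.1 q.2.2)) := by
    have : Measurable fun q : ℝ × ℝ × ℝ => F q.2.1 q.2.2 := hF.comp measurable_snd
    fun_prop
  have h2 : ∀ x : ℝ, I x * (∫⁻ s, ∫⁻ v, I (x - s) * (I (x - r * s - v) * F s v))
      = ∫⁻ p : ℝ × ℝ, I x * (I (x - p.1) * (I (x - r * p.1 - p.2) * F p.1 p.2)) := by
    intro x
    have hmx' : Measurable fun p : ℝ × ℝ =>
        (I (x - p.1) * (I (x - r * p.1 - p.2) * F p.1 p.2)) := by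
      have : Measurable fun q : ℝ × ℝ => F q.1 q.2 := hF
      fun_prop
    rw [lintegral_const_mul _ hmx', Measure.volume_eq_prod, lintegral_prod _ hmx'.aemeasurable]
  simp_rw [h2]
  rw [lintegral_lintegral_swap hm.aemeasurable, Measure.volume_eq_prod,
    lintegral_prod _ (hm.lintegral_prod_left').aemeasurable]
  refine lintegral_congr fun s => lintegral_congr fun v => ?_
  have hms : MeasurableSet {x | x ∈ E ∧ x + (-s) ∈ E ∧ x + (-(r * s) - v) ∈ E} :=
    hE.inter ((measurable_add_const (-s) hE).inter (measurable_add_const (-(r * s) - v) hE))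
  rw [← lintegral_indicator_one hms, ← lintegral_const_mul _ (measurable_one.indicator hms)]
  refine lintegral_congr fun x => ?_
  have e1 : x + (-s) = x - s := by ring
  have e2 : x + (-(r * s) - v) = x - r * s - v := by ring
  by_cases a : x ∈ E <;> by_cases b : x - s ∈ E <;> by_cases d : x - r * s - v ∈ E <;>
    simp [Set.indicator, hI, e1, e2, a, b, d]

lemma mul_lintegral_le_lintegral_prod {μ : Measure ℝ} [SFinite μ] {E : Set ℝ} {c : ℝ≥0∞}
    (hle : c • volume.restrict E ≤ μ) {Φ : ℝ × ℝ × ℝ → ℝ≥0∞} (hΦ : Measurable Φ) :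
    c * (c * (c * ∫⁻ x in E, ∫⁻ y in E, ∫⁻ w in E, Φ (x, y, w)))
      ≤ ∫⁻ p, Φ p ∂(μ.prod (μ.prod μ)) := by
  have hm2 : ∀ x : ℝ, Measurable fun y => ∫⁻ w in E, Φ (x, y, w) := fun x =>
    Measurable.lintegral_prod_right' (f := fun q : ℝ × ℝ => Φ (x, q))
      (hΦ.comp measurable_prodMk_left)
  have hm3 : Measurable fun x => ∫⁻ y in E, ∫⁻ w in E, Φ (x, y, w) := by
    refine Measurable.lintegral_prod_right' (f := fun q : ℝ × ℝ => ∫⁻ w in E, Φ (q.1, q.2, w)) ?_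
    refine Measurable.lintegral_prod_right'
      (f := fun q : (ℝ × ℝ) × ℝ => Φ (q.1.1, q.1.2, q.2)) ?_
    exact hΦ.comp (by fun_prop)
  have hmono : ∀ f g : ℝ → ℝ≥0∞, (∀ x, f x ≤ g x) → c * ∫⁻ x in E, f x ≤ ∫⁻ x, g x ∂μ := by
    intro f g hfg
    rw [← smul_eq_mul, ← lintegral_smul_measure]
    exact lintegral_mono' hle hfg
  rw [lintegral_prod _ hΦ.aemeasurable, ← lintegral_const_mul _ hm3,
    ← lintegral_const_mul _ (hm3.const_mul c)]
  refine hmono _ _ fun x => ?_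
  have hx : Measurable fun q : ℝ × ℝ => Φ (x, q) := hΦ.comp measurable_prodMk_left
  rw [lintegral_prod _ hx.aemeasurable, ← lintegral_const_mul _ (hm2 x)]
  exact hmono _ _ fun y => hmono _ _ fun w => le_rfl

lemma integrable_tentKernel_mul_weight (r : ℝ) {δ : ℝ} (hδ : 0 < δ) (μ : Measure ℝ)
    [IsFiniteMeasure μ] :
    Integrable (fun p : ℝ × ℝ × ℝ => tentKernel δ ((1 - r) * p.1 + r * p.2.1 - p.2.2) *
      (2 - 2 * Real.cos (Real.pi * (p.1 - p.2.1)))) (μ.prod (μ.prod μ)) := by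
  have hK := continuous_tentKernel δ
  refine (integrable_const (δ⁻¹ * 4)).mono' (by fun_prop) ?_
  filter_upwards with p
  rw [norm_mul, Real.norm_of_nonneg (tentKernel_nonneg hδ _), Real.norm_of_nonneg (weight_nonneg _)]
  refine mul_le_mul (tentKernel_le hδ _) ?_ (weight_nonneg _) (inv_nonneg.2 hδ.le)
  linarith [Real.neg_one_le_cos (Real.pi * (p.1 - p.2.1))]

lemma exists_pos_le_weightedForm (r : ℝ) {μ : Measure ℝ} [IsProbabilityMeasure μ]
    (hμ : μ ≪ volume) :
    ∃ κ > 0, ∃ δ₀ > 0, ∀ δ : ℝ, 0 < δ → δ < δ₀ → κ ≤ weightedForm r δ μ := by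
  obtain ⟨E, hE, hEpos, c, hc, hle⟩ :=
    exists_isCompact_smul_restrict_le (IsProbabilityMeasure.ne_zero μ) hμ
  obtain ⟨η, hη, hhalf⟩ := exists_half_measure_le_inter_translates hE hEpos
  -- For `|s| < ρ` and `|v| < η / 2` both shifts, `s` and `r s + v`, stay below `η`; the cap at 1
  -- keeps the weight positive on `(0, ρ)`.
  set ρ : ℝ := min (η / (2 * (1 + |r|))) 1 with hρ
  have hρ0 : 0 < ρ := lt_min (by positivity) one_pos
  have hρ1 : ρ ≤ 1 := min_le_right _ _
  have hρ2 : ρ * (1 + |r|) ≤ η / 2 := by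
    have : ρ ≤ η / (2 * (1 + |r|)) := min_le_left _ _
    rw [le_div_iff₀ (by positivity)] at this
    linarith
  set B : ℝ≥0∞ := ∫⁻ s in Set.Ioo 0 ρ, ENNReal.ofReal (2 - 2 * Real.cos (Real.pi * s)) with hB
  have hBpos : 0 < B := by
    rw [hB, setLIntegral_pos_iff (by fun_prop)]
    have : Set.Ioo 0 ρ ⊆ (Function.support fun s : ℝ =>
        ENNReal.ofReal (2 - 2 * Real.cos (Real.pi * s))) ∩ Set.Ioo 0 ρ := by
      intro s hs
      refine ⟨?_, hs⟩
      simpa using weight_pos hs.1 (hs.2.trans_le hρ1)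
    exact lt_of_lt_of_le (by simpa using hρ0) (measure_mono this)
  set κ : ℝ≥0∞ := c * (c * (c * (B * (1 / 2 * (volume E / 2))))) with hκ
  have hκ0 : 0 < κ := by
    have := hEpos.ne'
    have := hc.ne'
    have := hBpos.ne'
    rw [pos_iff_ne_zero]
    refine mul_ne_zero ‹_› (mul_ne_zero ‹_› (mul_ne_zero ‹_› (mul_ne_zero ‹_› ?_)))
    simpa using hEpos.ne'
  have main : ∀ δ : ℝ, 0 < δ → δ < η / 2 → κ ≤ ENNReal.ofReal (weightedForm r δ μ) := by
    intro δ hδ hδ2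
    set F : ℝ → ℝ → ℝ≥0∞ := fun s v =>
      ENNReal.ofReal (tentKernel δ v * (2 - 2 * Real.cos (Real.pi * s))) with hF
    have hKm : Measurable (tentKernel δ) := (continuous_tentKernel δ).measurable
    have hFm : Measurable (Function.uncurry F) := by
      simp only [hF, Function.uncurry_def]
      fun_prop
    have hFm' : Measurable fun p : ℝ × ℝ × ℝ =>
        F (p.1 - p.2.1) ((1 - r) * p.1 + r * p.2.1 - p.2.2) := by
      simp only [hF]
      fun_prop
    have step1 : ENNReal.ofReal (weightedForm r δ μ)
        = ∫⁻ p, F (p.1 - p.2.1) ((1 - r) * p.1 + r * p.2.1 - p.2.2) ∂(μ.prod (μ.prod μ)) := by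
      unfold weightedForm
      rw [ofReal_integral_eq_lintegral_ofReal (integrable_tentKernel_mul_weight r hδ μ)]
      exact ae_of_all _ fun p => mul_nonneg (tentKernel_nonneg hδ _) (weight_nonneg _)
    rw [step1]
    refine le_trans ?_ (mul_lintegral_le_lintegral_prod hle hFm')
    rw [lintegral_triple_change_variables hE.measurableSet hFm]
    rw [hκ]
    refine mul_le_mul_right (mul_le_mul_right (mul_le_mul_right ?_ c) c) c
    rw [hB, ← lintegral_mul_const _ (by fun_prop)]
    refine le_trans ?_ (setLIntegral_le_lintegral (Set.Ioo 0 ρ) _)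
    refine setLIntegral_mono' measurableSet_Ioo fun s hs => ?_
    have hKm' : Measurable fun v => ENNReal.ofReal (tentKernel δ v) := by fun_prop
    calc ENNReal.ofReal (2 - 2 * Real.cos (Real.pi * s)) * (1 / 2 * (volume E / 2))
        ≤ ENNReal.ofReal (2 - 2 * Real.cos (Real.pi * s)) *
          ((∫⁻ v, ENNReal.ofReal (tentKernel δ v)) * (volume E / 2)) := by
          gcongr
          exact half_le_lintegral_tentKernel hδ
      _ = ∫⁻ v, ENNReal.ofReal (2 - 2 * Real.cos (Real.pi * s)) *
          (ENNReal.ofReal (tentKernel δ v) * (volume E / 2)) := by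
          rw [lintegral_const_mul _ (by fun_prop), lintegral_mul_const _ hKm']
      _ ≤ _ := by
          refine lintegral_mono fun v => ?_
          have e : F s v = ENNReal.ofReal (tentKernel δ v) *
              ENNReal.ofReal (2 - 2 * Real.cos (Real.pi * s)) :=
            ENNReal.ofReal_mul (tentKernel_nonneg hδ v)
          rw [e, ← mul_assoc, mul_comm (ENNReal.ofReal (2 - 2 * Real.cos (Real.pi * s)))]
          rcases le_or_gt δ |v| with hv | hv
          · simp [tentKernel_of_le hδ hv]
          · gcongr
            have hs0 : |s| < ρ := by rw [abs_of_pos hs.1]; exact hs.2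
            apply hhalf
            · rw [abs_neg]
              nlinarith [abs_nonneg r]
            · calc |-(r * s) - v| ≤ |-(r * s)| + |v| := abs_sub _ _
                _ = |r| * |s| + |v| := by rw [abs_neg, abs_mul]
                _ < η := by nlinarith [abs_nonneg r]
  -- Nothing above says that `c` is finite, so `κ` is truncated before `toReal`, which would send
  -- `⊤` to 0.
  refine ⟨(min κ 1).toReal, ENNReal.toReal_pos (lt_min hκ0 one_pos).ne' (by simp), η / 2,
    by positivity, fun δ hδ hδ2 => ?_⟩
  have h := main δ hδ hδ2
  have hnn : 0 ≤ weightedForm r δ μ :=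
    integral_nonneg fun p => mul_nonneg (tentKernel_nonneg hδ _) (weight_nonneg _)
  exact ENNReal.toReal_le_of_le_ofReal hnn ((min_le_left _ _).trans h)

/-! ### From Frostman and `L⁴` bounds to decay in `L³`. -/

lemma integral_tentKernel_sub_eq {δ : ℝ} (hδ : 0 < δ) (μ : Measure ℝ) [IsFiniteMeasure μ] :
    ∫ p, tentKernel δ (p.1 - p.2) ∂(μ.prod μ)
      = ∫ ξ : ℝ, sincSq (δ * ξ) * ‖fourierTransform μ ξ‖ ^ 2 := by
  have h := integral_tentKernel_mul_echar (μ.prod μ) (a := fun p => p.1 - p.2) (b := fun _ => 0)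
    (by fun_prop) (by fun_prop) hδ
  have h2 : ∀ ξ : ℝ, ∫ p, echar ((p.1 - p.2) * ξ + 0) ∂(μ.prod μ)
      = ((‖fourierTransform μ ξ‖ ^ 2 : ℝ) : ℂ) := by
    intro ξ
    have h3 : ∀ p : ℝ × ℝ, echar ((p.1 - p.2) * ξ + 0)
        = echar (-(p.1 * -ξ)) * echar (-(p.2 * ξ)) := by
      intro p
      rw [← echar_add]
      congr 1
      ring
    simp_rw [h3]
    rw [integral_prod_mul (fun x => echar (-(x * -ξ))) (fun x => echar (-(x * ξ))),
      ← fourierTransform_eq_echar, ← fourierTransform_eq_echar, fourierTransform_neg,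
      Complex.conj_mul']
    push_cast
    rfl
  simp_rw [h2, echar_zero, mul_one, ← Complex.ofReal_mul, integral_complex_ofReal] at h
  exact_mod_cast h

/-- The weighted `L²` integral equals a double integral of the tent kernel at scale `δ`, which is at
most `δ⁻¹` times the largest mass of an interval of radius `δ`. The factor 4 comes from
`quarter_le_sincSq`. -/
lemma lintegral_sq_fourierTransform_le {δ B : ℝ} (hδ : 0 < δ) (μ : Measure ℝ)
    [IsProbabilityMeasure μ]
    (hB : ∀ y, μ (Set.Icc (y - δ) (y + δ)) ≤ ENNReal.ofReal B) :
    ∫⁻ ξ in {ξ : ℝ | |δ * ξ| ≤ 1 / 2}, ‖fourierTransform μ ξ‖ₑ ^ 2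
      ≤ 4 * (ENNReal.ofReal δ⁻¹ * ENNReal.ofReal B) := by
  have hK : Measurable (tentKernel δ) := (continuous_tentKernel δ).measurable
  have hft := measurable_fourierTransform μ
  have hg : Measurable sincSq := continuous_sincSq.measurable
  have hint1 : Integrable (fun p : ℝ × ℝ => tentKernel δ (p.1 - p.2)) (μ.prod μ) := by
    refine (integrable_const δ⁻¹).mono' (Measurable.aestronglyMeasurable (by fun_prop)) ?_
    filter_upwards with p
    rw [Real.norm_of_nonneg (tentKernel_nonneg hδ _)]
    exact tentKernel_le hδ _
  have hint2 : Integrable fun ξ : ℝ => sincSq (δ * ξ) * ‖fourierTransform μ ξ‖ ^ 2 := by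
    refine (integrable_sincSq_mul hδ).mul_bdd (c := 1)
      (Measurable.aestronglyMeasurable (by fun_prop)) (ae_of_all _ fun ξ => ?_)
    rw [Real.norm_of_nonneg (by positivity)]
    exact pow_le_one₀ (norm_nonneg _) (norm_fourierTransform_le_one μ ξ)
  have h1 : ENNReal.ofReal (∫ p, tentKernel δ (p.1 - p.2) ∂(μ.prod μ))
      ≤ ENNReal.ofReal δ⁻¹ * ENNReal.ofReal B := by
    rw [ofReal_integral_eq_lintegral_ofReal hint1 (ae_of_all _ fun p => tentKernel_nonneg hδ _),
      lintegral_prod _ (Measurable.aemeasurable (by fun_prop))]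
    have h2 : ∀ x : ℝ, ∫⁻ y, ENNReal.ofReal (tentKernel δ (x - y)) ∂μ
        ≤ ENNReal.ofReal δ⁻¹ * ENNReal.ofReal B := by
      intro x
      calc ∫⁻ y, ENNReal.ofReal (tentKernel δ (x - y)) ∂μ
          ≤ ∫⁻ y, (Set.Icc (x - δ) (x + δ)).indicator (fun _ => ENNReal.ofReal δ⁻¹) y ∂μ := by
            refine lintegral_mono fun y => ?_
            by_cases hy : y ∈ Set.Icc (x - δ) (x + δ)
            · rw [Set.indicator_of_mem hy]
              exact ENNReal.ofReal_le_ofReal (tentKernel_le hδ _)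
            · rw [Set.indicator_of_notMem hy, tentKernel_of_le hδ, ENNReal.ofReal_zero]
              by_contra hlt
              rw [not_le, abs_lt] at hlt
              exact hy ⟨by linarith, by linarith⟩
        _ = ENNReal.ofReal δ⁻¹ * μ (Set.Icc (x - δ) (x + δ)) :=
            lintegral_indicator_const measurableSet_Icc _
        _ ≤ _ := by gcongr; exact hB x
    calc ∫⁻ x, ∫⁻ y, ENNReal.ofReal (tentKernel δ (x - y)) ∂μ ∂μ
        ≤ ∫⁻ _, ENNReal.ofReal δ⁻¹ * ENNReal.ofReal B ∂μ := lintegral_mono h2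
      _ = _ := by simp
  rw [integral_tentKernel_sub_eq hδ, ofReal_integral_eq_lintegral_ofReal hint2
    (ae_of_all _ fun ξ => mul_nonneg (sincSq_nonneg _) (by positivity))] at h1
  have hS : MeasurableSet {ξ : ℝ | |δ * ξ| ≤ 1 / 2} :=
    measurableSet_le (by fun_prop) measurable_const
  calc ∫⁻ ξ in {ξ : ℝ | |δ * ξ| ≤ 1 / 2}, ‖fourierTransform μ ξ‖ₑ ^ 2
      ≤ ∫⁻ ξ in {ξ : ℝ | |δ * ξ| ≤ 1 / 2},
          4 * ENNReal.ofReal (sincSq (δ * ξ) * ‖fourierTransform μ ξ‖ ^ 2) := by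
        refine setLIntegral_mono' hS fun ξ hξ => ?_
        rw [← ofReal_norm, ← ENNReal.ofReal_pow (norm_nonneg _)]
        have e4 : (4 : ℝ≥0∞) = ENNReal.ofReal 4 := by simp
        rw [e4, ← ENNReal.ofReal_mul (by norm_num)]
        apply ENNReal.ofReal_le_ofReal
        nlinarith [quarter_le_sincSq hξ, sq_nonneg ‖fourierTransform μ ξ‖]
    _ ≤ ∫⁻ ξ, 4 * ENNReal.ofReal (sincSq (δ * ξ) * ‖fourierTransform μ ξ‖ ^ 2) :=
        setLIntegral_le_lintegral _ _
    _ = 4 * ∫⁻ ξ, ENNReal.ofReal (sincSq (δ * ξ) * ‖fourierTransform μ ξ‖ ^ 2) :=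
        lintegral_const_mul _ (by fun_prop)
    _ ≤ _ := by gcongr

lemma measurableSet_annulus (l : ℕ) : MeasurableSet (annulus l) :=
  (measurableSet_Icc (a := (2 : ℝ) ^ ((l : ℤ) - 1)) (b := (2 : ℝ) ^ ((l : ℤ) + 1))).preimage
    (measurable_norm (α := ℝ))

lemma lintegral_annulus_pow_four_le {μ : Measure ℝ} [IsFiniteMeasure μ] {l : ℕ} {X : ℝ≥0∞}
    (h : eLpNorm ((annulus l).indicator (fourierTransform μ)) 4 volume ≤ X) :
    ∫⁻ ξ in annulus l, ‖fourierTransform μ ξ‖ₑ ^ 4 ≤ X ^ 4 := by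
  rw [eLpNorm_indicator_eq_eLpNorm_restrict (measurableSet_annulus l)] at h
  have h4 := eLpNorm_nnreal_pow_eq_lintegral (f := fourierTransform μ)
    (μ := volume.restrict (annulus l)) (p := (4 : ℝ≥0)) (by norm_num)
  have e : ((4 : ℝ≥0) : ℝ) = ((4 : ℕ) : ℝ) := by norm_num
  simp_rw [e, ENNReal.rpow_natCast] at h4
  rw [← h4]
  gcongr
  exact_mod_cast h

/-- AM-GM with a free parameter; it replaces Hölder interpolation between `L²` and `L⁴`. -/
lemma enorm_pow_three_le (z : ℂ) {lam : ℝ} (hlam : 0 < lam) :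
    ‖z‖ₑ ^ 3 ≤ ENNReal.ofReal lam * ‖z‖ₑ ^ 2 + ENNReal.ofReal lam⁻¹ * ‖z‖ₑ ^ 4 := by
  rw [← ofReal_norm]
  simp only [← ENNReal.ofReal_pow (norm_nonneg z)]
  rw [← ENNReal.ofReal_mul hlam.le, ← ENNReal.ofReal_mul (inv_nonneg.2 hlam.le),
    ← ENNReal.ofReal_add (by positivity) (by positivity)]
  apply ENNReal.ofReal_le_ofReal
  have h : 0 ≤ lam⁻¹ * (‖z‖ * (‖z‖ - lam)) ^ 2 := by positivity
  have h2 : lam⁻¹ * (‖z‖ * (‖z‖ - lam)) ^ 2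
      = lam⁻¹ * ‖z‖ ^ 4 - 2 * ‖z‖ ^ 3 + lam * ‖z‖ ^ 2 := by
    field_simp
    ring
  have h3 : 0 ≤ ‖z‖ ^ 3 := by positivity
  linarith

lemma IsProbabilityOn.measure_Icc {μ : Measure ℝ} {A : Set ℝ} (h : IsProbabilityOn μ A)
    (hA : A ⊆ Set.Icc 0 1) : μ (Set.Icc 0 1) = 1 := by
  have := h.1
  rw [prob_compl_eq_zero_iff measurableSet_Icc |>.1]
  exact measure_mono_null (Set.compl_subset_compl.2 hA) h.2

lemma IsFrostman.one_le {μ : Measure ℝ} {Λ β : ℝ} (h : IsFrostman μ Λ β)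
    (h1 : μ (Set.Icc 0 1) = 1) : 1 ≤ Λ := by
  have := h 0 1 zero_lt_one
  rw [h1] at this
  simpa using this

lemma IsFrostman.measure_Icc_le {μ : Measure ℝ} {Λ β ε a b : ℝ} (h : IsFrostman μ Λ β)
    (hΛ : 0 ≤ Λ) (hε : 1 - ε ≤ β) (hab : a < b) (hab1 : b - a ≤ 1) :
    μ (Set.Icc a b) ≤ ENNReal.ofReal (Λ * (b - a) ^ (1 - ε)) := by
  refine (h a b hab).trans (ENNReal.ofReal_le_ofReal ?_)
  exact mul_le_mul_of_nonneg_left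
    (Real.rpow_le_rpow_of_exponent_ge (by linarith) hab1 hε) hΛ

/-- The `L²` integral grows at most like `2 ^ (c₀ l / 2)`, as the Frostman deficiency is at most `c₀
/ 2`. The `L⁴` integral decays like `2 ^ (-2 c₀ l)`, as `ω l ≤ c₀ / 2`. -/
lemma lintegral_annulus_pow_three_le {μ : Measure ℝ} [IsProbabilityMeasure μ]
    {Λ β c₀ K : ℝ} {ω : ℕ → ℝ} (hc₀ : 0 < c₀) (hΛ : 0 ≤ Λ)
    (hβ : 1 - min (c₀ / 2) 1 ≤ β) (hfr : IsFrostman μ Λ β) (hfu : IsFourierUniform μ K ω c₀)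
    {l : ℕ} (hl : 1 ≤ l) (hω : ω l ≤ c₀ / 2) :
    ∫⁻ ξ in annulus l, ‖fourierTransform μ ξ‖ₑ ^ 3
      ≤ ENNReal.ofReal ((16 * Λ + K ^ 4) * ((2 : ℝ) ^ (-(c₀ / 2))) ^ l) := by
  set ε := min (c₀ / 2) 1 with hε
  have hε0 : 0 < ε := lt_min (by positivity) one_pos
  have hε1 : ε ≤ 1 := min_le_right _ _
  have hε2 : ε ≤ c₀ / 2 := min_le_left _ _
  have hft := measurable_fourierTransform μ
  -- Chosen so that `|ξ| ≤ 2 ^ (l + 1)` gives `|δ ξ| ≤ 1 / 2`.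
  set δ : ℝ := (2 : ℝ) ^ (-((l : ℝ) + 2)) with hδdef
  have hδ : 0 < δ := by positivity
  have h2δ : 2 * δ = (2 : ℝ) ^ (-((l : ℝ) + 1)) := by
    rw [hδdef, show -((l : ℝ) + 1) = 1 + -((l : ℝ) + 2) by ring, Real.rpow_add two_pos,
      Real.rpow_one]
  have h2δ1 : 2 * δ ≤ 1 := by
    rw [h2δ]
    exact Real.rpow_le_one_of_one_le_of_nonpos one_le_two (by linarith [Nat.cast_nonneg (α := ℝ) l])
  have hsub : annulus l ⊆ {ξ : ℝ | |δ * ξ| ≤ 1 / 2} := by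
    intro ξ hξ
    have h1 : |ξ| ≤ (2 : ℝ) ^ ((l : ℝ) + 1) := by
      have := hξ.2
      rw [← Real.rpow_intCast] at this
      push_cast at this
      exact this
    have : |δ * ξ| ≤ δ * (2 : ℝ) ^ ((l : ℝ) + 1) := by
      rw [abs_mul, abs_of_pos hδ]
      gcongr
    refine this.trans (le_of_eq ?_)
    rw [hδdef, ← Real.rpow_add two_pos, show -((l : ℝ) + 2) + ((l : ℝ) + 1) = -1 by ring,
      Real.rpow_neg_one]
    norm_num
  have hL2 : ∫⁻ ξ in annulus l, ‖fourierTransform μ ξ‖ₑ ^ 2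
      ≤ ENNReal.ofReal (16 * Λ * (2 : ℝ) ^ (c₀ / 2 * l)) := by
    refine (lintegral_mono_set hsub).trans
      ((lintegral_sq_fourierTransform_le (B := Λ * (2 * δ) ^ (1 - ε)) hδ μ fun y => ?_).trans ?_)
    · have := hfr.measure_Icc_le (ε := ε) (a := y - δ) (b := y + δ) hΛ hβ (by linarith)
        (by linarith)
      rwa [show y + δ - (y - δ) = 2 * δ by ring] at this
    · rw [← ENNReal.ofReal_mul (by positivity)]
      have e4 : (4 : ℝ≥0∞) = ENNReal.ofReal 4 := by simp
      rw [e4, ← ENNReal.ofReal_mul (by norm_num)]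
      apply ENNReal.ofReal_le_ofReal
      have h3 : (2 * δ) ^ (1 - ε) = 2 * δ * (2 : ℝ) ^ (ε * (l + 1)) := by
        rw [Real.rpow_sub (by positivity), Real.rpow_one, h2δ, ← Real.rpow_mul (by norm_num),
          div_eq_mul_inv, ← Real.rpow_neg (by norm_num)]
        congr 2
        ring
      have h4 : (2 : ℝ) ^ (ε * (l + 1)) ≤ 2 * (2 : ℝ) ^ (c₀ / 2 * l) := by
        have : (2 : ℝ) * (2 : ℝ) ^ (c₀ / 2 * l) = (2 : ℝ) ^ (1 + c₀ / 2 * l) := by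
          rw [Real.rpow_add two_pos, Real.rpow_one]
        rw [this]
        apply Real.rpow_le_rpow_of_exponent_le one_le_two
        nlinarith [Nat.cast_nonneg (α := ℝ) l]
      rw [h3]
      calc 4 * (δ⁻¹ * (Λ * (2 * δ * (2 : ℝ) ^ (ε * (l + 1)))))
          = 8 * Λ * (2 : ℝ) ^ (ε * (l + 1)) := by field_simp; ring
        _ ≤ 8 * Λ * (2 * (2 : ℝ) ^ (c₀ / 2 * l)) := by gcongr
        _ = _ := by ring
  have hL4 : ∫⁻ ξ in annulus l, ‖fourierTransform μ ξ‖ₑ ^ 4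
      ≤ ENNReal.ofReal (K ^ 4 * (2 : ℝ) ^ (-(2 * c₀ * l))) := by
    refine (lintegral_annulus_pow_four_le (hfu l hl)).trans ?_
    calc ENNReal.ofReal (K * (2 : ℝ) ^ ((ω l - c₀) * l)) ^ 4
        ≤ ENNReal.ofReal (|K| * (2 : ℝ) ^ ((ω l - c₀) * l)) ^ 4 := by
          gcongr
          exact le_abs_self K
      _ = ENNReal.ofReal (K ^ 4 * ((2 : ℝ) ^ ((ω l - c₀) * l)) ^ 4) := by
          rw [← ENNReal.ofReal_pow (by positivity), mul_pow, Even.pow_abs ⟨2, rfl⟩]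
      _ ≤ _ := by
          apply ENNReal.ofReal_le_ofReal
          gcongr
          rw [← Real.rpow_natCast, ← Real.rpow_mul (by norm_num)]
          apply Real.rpow_le_rpow_of_exponent_le one_le_two
          push_cast
          nlinarith [Nat.cast_nonneg (α := ℝ) l]
  -- With this parameter the two terms decay like `2 ^ (-c₀ l / 2)` and `2 ^ (-c₀ l)`; the first
  -- rate is kept for both.
  set lam : ℝ := (2 : ℝ) ^ (-(c₀ * l)) with hlam
  have hlam0 : 0 < lam := by positivity
  calc ∫⁻ ξ in annulus l, ‖fourierTransform μ ξ‖ₑ ^ 3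
      ≤ ∫⁻ ξ in annulus l, (ENNReal.ofReal lam * ‖fourierTransform μ ξ‖ₑ ^ 2
          + ENNReal.ofReal lam⁻¹ * ‖fourierTransform μ ξ‖ₑ ^ 4) :=
        lintegral_mono fun ξ => enorm_pow_three_le _ hlam0
    _ = ENNReal.ofReal lam * (∫⁻ ξ in annulus l, ‖fourierTransform μ ξ‖ₑ ^ 2)
          + ENNReal.ofReal lam⁻¹ * ∫⁻ ξ in annulus l, ‖fourierTransform μ ξ‖ₑ ^ 4 := by
        rw [lintegral_add_left (by fun_prop), lintegral_const_mul _ (by fun_prop),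
          lintegral_const_mul _ (by fun_prop)]
    _ ≤ ENNReal.ofReal lam * ENNReal.ofReal (16 * Λ * (2 : ℝ) ^ (c₀ / 2 * l))
          + ENNReal.ofReal lam⁻¹ * ENNReal.ofReal (K ^ 4 * (2 : ℝ) ^ (-(2 * c₀ * l))) := by
        gcongr
    _ = ENNReal.ofReal (lam * (16 * Λ * (2 : ℝ) ^ (c₀ / 2 * l))
          + lam⁻¹ * (K ^ 4 * (2 : ℝ) ^ (-(2 * c₀ * l)))) := by
        rw [ENNReal.ofReal_add (by positivity) (by positivity), ENNReal.ofReal_mul hlam0.le,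
          ENNReal.ofReal_mul (inv_nonneg.2 hlam0.le)]
    _ ≤ _ := by
        apply ENNReal.ofReal_le_ofReal
        have e1 : lam * (2 : ℝ) ^ (c₀ / 2 * l) = ((2 : ℝ) ^ (-(c₀ / 2))) ^ l := by
          rw [hlam, ← Real.rpow_add two_pos, ← Real.rpow_natCast, ← Real.rpow_mul (by norm_num)]
          congr 1
          ring
        have e2 : lam⁻¹ * (2 : ℝ) ^ (-(2 * c₀ * l)) ≤ ((2 : ℝ) ^ (-(c₀ / 2))) ^ l := by
          rw [hlam, ← Real.rpow_neg (by norm_num), ← Real.rpow_add two_pos, ← Real.rpow_natCast,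
            ← Real.rpow_mul (by norm_num)]
          apply Real.rpow_le_rpow_of_exponent_le one_le_two
          nlinarith [mul_nonneg hc₀.le (Nat.cast_nonneg (α := ℝ) l)]
        have hK4 : 0 ≤ K ^ 4 := by positivity
        calc lam * (16 * Λ * (2 : ℝ) ^ (c₀ / 2 * l))
              + lam⁻¹ * (K ^ 4 * (2 : ℝ) ^ (-(2 * c₀ * l)))
            = 16 * Λ * (lam * (2 : ℝ) ^ (c₀ / 2 * l))
              + K ^ 4 * (lam⁻¹ * (2 : ℝ) ^ (-(2 * c₀ * l))) := by ring
          _ ≤ 16 * Λ * ((2 : ℝ) ^ (-(c₀ / 2))) ^ l + K ^ 4 * ((2 : ℝ) ^ (-(c₀ / 2))) ^ l := by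
              rw [e1]
              gcongr
          _ = _ := by ring

/-! ### Uniform tails on the frequency side. -/

/-- The integrals of a family of functions over `|ξ| ≥ R` are uniformly small for large `R`. -/
def HasUniformTails {ι : Type*} (F : ι → ℝ → ℝ≥0∞) : Prop :=
  ∀ ε : ℝ≥0∞, 0 < ε → ∃ R : ℝ, 0 < R ∧ ∀ i, ∫⁻ ξ in {ξ : ℝ | R ≤ |ξ|}, F i ξ ≤ ε

/-- Sum the geometric bounds over the annuli beyond `2 ^ L`. The radius depends on `Λ`, `K`, `c₀`,
`ω` and `ε` but not on the measure, which gives uniformity along the sequence. -/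
lemma exists_radius_lintegral_pow_three_le {Λ c₀ K : ℝ} {ω : ℕ → ℝ} (hc₀ : 0 < c₀)
    (hω : Tendsto ω atTop (𝓝 0)) {ε : ℝ≥0∞} (hε : 0 < ε) :
    ∃ R : ℝ, 0 < R ∧ ∀ (μ : Measure ℝ) (β : ℝ), IsProbabilityMeasure μ → 0 ≤ Λ →
      1 - min (c₀ / 2) 1 ≤ β → IsFrostman μ Λ β → IsFourierUniform μ K ω c₀ →
      ∫⁻ ξ in {ξ : ℝ | R ≤ |ξ|}, ‖fourierTransform μ ξ‖ₑ ^ 3 ≤ ε := by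
  set q : ℝ := (2 : ℝ) ^ (-(c₀ / 2)) with hq
  have hq0 : 0 < q := by positivity
  have hq1 : q < 1 := Real.rpow_lt_one_of_one_lt_of_neg one_lt_two (by linarith)
  set C : ℝ := 16 * Λ + K ^ 4 with hC
  have hlim : Tendsto (fun L : ℕ => ENNReal.ofReal (C * q ^ L * (1 - q)⁻¹)) atTop (𝓝 0) := by
    rw [← ENNReal.ofReal_zero]
    refine ENNReal.tendsto_ofReal ?_
    have := ((tendsto_pow_atTop_nhds_zero_of_lt_one hq0.le hq1).const_mul C).mul_const (1 - q)⁻¹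
    simpa using this
  have hω' : ∀ᶠ l in atTop, ω l ≤ c₀ / 2 :=
    (hω.eventually_lt_const (u := c₀ / 2) (by positivity)).mono fun _ h => h.le
  obtain ⟨L₀, hL₀⟩ := eventually_atTop.1 hω'
  obtain ⟨L, hL1, hL2⟩ := ((hlim.eventually_lt_const hε).and
    (eventually_ge_atTop (max L₀ 1))).exists
  refine ⟨2 ^ L, by positivity, fun μ β hμ hΛ hβ hfr hfu => ?_⟩
  have hsub : {ξ : ℝ | (2 : ℝ) ^ L ≤ |ξ|} ⊆ ⋃ k : ℕ, annulus (L + k) := by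
    intro ξ hξ
    have hξ' : (2 : ℝ) ^ L ≤ |ξ| := hξ
    have h1 : 1 ≤ |ξ| / 2 ^ L := by rwa [one_le_div (by positivity)]
    obtain ⟨n, hn1, hn2⟩ := exists_nat_pow_near h1 one_lt_two
    rw [le_div_iff₀ (by positivity), ← pow_add] at hn1
    rw [div_lt_iff₀ (by positivity), ← pow_add] at hn2
    refine Set.mem_iUnion.2 ⟨n, ?_, ?_⟩
    · refine le_trans ?_ hn1
      rw [← zpow_natCast]
      apply zpow_le_zpow_right₀ one_le_two
      push_cast
      linarith
    · refine hn2.le.trans ?_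
      rw [← zpow_natCast]
      apply zpow_le_zpow_right₀ one_le_two
      push_cast
      linarith
  have hC0 : 0 ≤ C := by positivity
  calc ∫⁻ ξ in {ξ : ℝ | (2 : ℝ) ^ L ≤ |ξ|}, ‖fourierTransform μ ξ‖ₑ ^ 3
      ≤ ∫⁻ ξ in ⋃ k : ℕ, annulus (L + k), ‖fourierTransform μ ξ‖ₑ ^ 3 := lintegral_mono_set hsub
    _ ≤ ∑' k : ℕ, ∫⁻ ξ in annulus (L + k), ‖fourierTransform μ ξ‖ₑ ^ 3 := lintegral_iUnion_le _ _
    _ ≤ ∑' k : ℕ, ENNReal.ofReal (C * q ^ (L + k)) := by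
        refine ENNReal.tsum_le_tsum fun k => ?_
        exact lintegral_annulus_pow_three_le hc₀ hΛ hβ hfr hfu
          (by have := le_max_right L₀ 1; omega)
          (hL₀ _ (by have := le_max_left L₀ 1; omega))
    _ = ENNReal.ofReal (C * q ^ L * (1 - q)⁻¹) := by
        have hs : HasSum (fun k : ℕ => C * q ^ (L + k)) (C * q ^ L * (1 - q)⁻¹) := by
          have := (hasSum_geometric_of_lt_one hq0.le hq1).mul_left (C * q ^ L)
          simpa only [pow_add, mul_assoc] using this
        rw [← hs.tsum_eq, ENNReal.ofReal_tsum_of_nonneg (fun k => by positivity) hs.summable]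
    _ ≤ ε := hL1.le

lemma measurableSet_le_abs (R : ℝ) : MeasurableSet {ξ : ℝ | R ≤ |ξ|} :=
  measurableSet_le measurable_const (by fun_prop)

lemma compl_le_abs_subset_Icc (R : ℝ) : {ξ : ℝ | R ≤ |ξ|}ᶜ ⊆ Set.Icc (-R) R := by
  intro ξ hξ
  have h : ¬ R ≤ |ξ| := hξ
  exact abs_le.1 (not_le.1 h).le

lemma HasUniformTails.mono {ι : Type*} {F G : ι → ℝ → ℝ≥0∞} (hF : HasUniformTails F)
    (h : ∀ i ξ, G i ξ ≤ F i ξ) : HasUniformTails G := by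
  intro ε hε
  obtain ⟨R, hR, hRF⟩ := hF ε hε
  exact ⟨R, hR, fun i => (lintegral_mono (h i)).trans (hRF i)⟩

lemma HasUniformTails.add {ι : Type*} {F G : ι → ℝ → ℝ≥0∞} (hF : HasUniformTails F)
    (hG : HasUniformTails G) (hm : ∀ i, Measurable (F i)) :
    HasUniformTails fun i ξ => F i ξ + G i ξ := by
  intro ε hε
  obtain ⟨R, hR, hRF⟩ := hF (ε / 2) (ENNReal.half_pos hε.ne')
  obtain ⟨S, hS, hSG⟩ := hG (ε / 2) (ENNReal.half_pos hε.ne')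
  refine ⟨max R S, lt_max_of_lt_left hR, fun i => ?_⟩
  rw [lintegral_add_left (hm i), ← ENNReal.add_halves ε]
  refine add_le_add ((lintegral_mono_set ?_).trans (hRF i)) ((lintegral_mono_set ?_).trans (hSG i))
  · exact fun ξ hξ => (le_max_left R S).trans hξ
  · exact fun ξ hξ => (le_max_right R S).trans hξ

lemma lintegral_comp_affine {a : ℝ} (ha : a ≠ 0) (b : ℝ) {f : ℝ → ℝ≥0∞} (hf : Measurable f) :
    ∫⁻ ξ, f (a * ξ + b) = ENNReal.ofReal |a⁻¹| * ∫⁻ ξ, f ξ := by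
  have h1 : ∫⁻ ξ, f (a * ξ + b) = ∫⁻ ξ, f (ξ + b) ∂(Measure.map (a * ·) volume) := by
    rw [lintegral_map (by fun_prop) (by fun_prop)]
  rw [h1, Real.map_volume_mul_left ha, lintegral_smul_measure, smul_eq_mul,
    lintegral_add_right_eq_self f b]

lemma HasUniformTails.comp_affine {ι : Type*} {F : ι → ℝ → ℝ≥0∞} (hF : HasUniformTails F)
    (hm : ∀ i, Measurable (F i)) {a : ℝ} (ha : a ≠ 0) (b : ℝ) :
    HasUniformTails fun i ξ => F i (a * ξ + b) := by
  intro ε hε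
  have ha' : 0 < |a| := abs_pos.2 ha
  obtain ⟨R, hR, hRF⟩ := hF (ENNReal.ofReal |a| * ε)
    (ENNReal.mul_pos (by simpa using ha) hε.ne')
  refine ⟨(R + |b|) / |a|, by positivity, fun i => ?_⟩
  calc ∫⁻ ξ in {ξ : ℝ | (R + |b|) / |a| ≤ |ξ|}, F i (a * ξ + b)
      = ∫⁻ ξ, {ξ : ℝ | (R + |b|) / |a| ≤ |ξ|}.indicator (fun ξ => F i (a * ξ + b)) ξ :=
        (lintegral_indicator (measurableSet_le_abs _) _).symm
    _ ≤ ∫⁻ ξ, {ξ : ℝ | R ≤ |ξ|}.indicator (F i) (a * ξ + b) := by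
        refine lintegral_mono fun ξ => ?_
        by_cases hξ : ξ ∈ {ξ : ℝ | (R + |b|) / |a| ≤ |ξ|}
        · have h1 : a * ξ + b ∈ {ξ : ℝ | R ≤ |ξ|} := by
            have h2 : (R + |b|) / |a| ≤ |ξ| := hξ
            rw [div_le_iff₀ ha', mul_comm, ← abs_mul] at h2
            have h3 : |a * ξ| ≤ |a * ξ + b| + |b| := by
              simpa using abs_sub (a * ξ + b) b
            show R ≤ |a * ξ + b|
            linarith
          rw [Set.indicator_of_mem hξ, Set.indicator_of_mem h1]
        · rw [Set.indicator_of_notMem hξ]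
          exact zero_le
    _ = ENNReal.ofReal |a⁻¹| * ∫⁻ ξ, {ξ : ℝ | R ≤ |ξ|}.indicator (F i) ξ :=
        lintegral_comp_affine ha b ((hm i).indicator (measurableSet_le_abs R))
    _ = ENNReal.ofReal |a⁻¹| * ∫⁻ ξ in {ξ : ℝ | R ≤ |ξ|}, F i ξ := by
        rw [lintegral_indicator (measurableSet_le_abs R)]
    _ ≤ ENNReal.ofReal |a⁻¹| * (ENNReal.ofReal |a| * ε) := by
        gcongr
        exact hRF i
    _ = ε := by
        rw [← mul_assoc, ← ENNReal.ofReal_mul (abs_nonneg _), ← abs_mul, inv_mul_cancel₀ ha]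
        simp

lemma mul_mul_le_add_pow_three (a b c : ℝ≥0∞) : a * (b * c) ≤ a ^ 3 + (b ^ 3 + c ^ 3) := by
  set m := max a (max b c) with hm
  have h1 : a * (b * c) ≤ m ^ 3 := by
    rw [pow_three]
    gcongr <;> simp [hm]
  refine h1.trans ?_
  rcases le_total (max b c) a with h | h
  · rw [hm, max_eq_left h]
    exact le_self_add
  · rw [hm, max_eq_right h]
    refine le_trans ?_ le_add_self
    rcases le_total b c with h' | h'
    · rw [max_eq_right h']
      exact le_add_self
    · rw [max_eq_left h']
      exact le_self_add

/-- Since `r ≠ 0, 1`, all three arguments are nonconstant affine functions of `ξ`, so the tails of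
each cube transfer. -/
lemma HasUniformTails.freqForm {ι : Type*} {μ : ι → Measure ℝ}
    [∀ i, IsProbabilityMeasure (μ i)] {r : ℝ} (hr0 : r ≠ 0) (hr1 : r ≠ 1)
    (h : HasUniformTails fun i ξ => ‖fourierTransform (μ i) ξ‖ₑ ^ 3) (u : ℝ) :
    HasUniformTails fun i ξ => ‖freqForm r u (μ i) ξ‖ₑ := by
  have hft := fun i => measurable_fourierTransform (μ i)
  have hm : ∀ i, Measurable fun ξ => ‖fourierTransform (μ i) ξ‖ₑ ^ 3 := fun i => by
    have := hft i
    fun_prop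
  have h1 := h.comp_affine hm (a := -(1 - r)) (neg_ne_zero.2 (sub_ne_zero.2 hr1.symm)) (-u)
  have h2 := h.comp_affine hm (a := -r) (neg_ne_zero.2 hr0) u
  refine (h1.add (h2.add h ?_) ?_).mono fun i ξ => ?_
  · intro i
    have := hft i
    fun_prop
  · intro i
    have := hft i
    fun_prop
  · unfold Roth.freqForm
    rw [enorm_mul, enorm_mul, show -(1 - r) * ξ + -u = -((1 - r) * ξ + u) by ring,
      show -r * ξ + u = -(r * ξ - u) by ring]
    exact mul_mul_le_add_pow_three _ _ _

lemma HasUniformTails.weightedFreq {ι : Type*} {μ : ι → Measure ℝ}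
    [∀ i, IsProbabilityMeasure (μ i)] {r : ℝ} (hr0 : r ≠ 0) (hr1 : r ≠ 1)
    (h : HasUniformTails fun i ξ => ‖fourierTransform (μ i) ξ‖ₑ ^ 3) :
    HasUniformTails fun i ξ => ‖weightedFreq r (μ i) ξ‖ₑ := by
  have h0 := h.freqForm hr0 hr1
  have hm : ∀ u i, Measurable fun ξ => ‖Roth.freqForm r u (μ i) ξ‖ₑ := fun u i =>
    (measurable_freqForm r u (μ i)).enorm
  refine ((((h0 0).add (h0 0) (hm 0)).add (h0 (1 / 2)) fun i => (hm 0 i).add (hm 0 i)).add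
    (h0 (-(1 / 2))) fun i => ((hm 0 i).add (hm 0 i)).add (hm _ i)).mono fun i ξ => ?_
  unfold Roth.weightedFreq
  rw [two_mul]
  refine (enorm_sub_le).trans (add_le_add (enorm_sub_le.trans (add_le_add ?_ le_rfl)) le_rfl)
  exact enorm_add_le _ _

lemma HasUniformTails.integrable {ι : Type*} {F : ι → ℝ → ℂ}
    (h : HasUniformTails fun i ξ => ‖F i ξ‖ₑ) (hm : ∀ i, Measurable (F i)) {C : ℝ}
    (hC : ∀ i ξ, ‖F i ξ‖ ≤ C) (i : ι) : Integrable (F i) := by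
  refine ⟨(hm i).aestronglyMeasurable, ?_⟩
  obtain ⟨R, hR, hRF⟩ := h 1 one_pos
  rw [hasFiniteIntegral_iff_enorm,
    ← lintegral_add_compl _ (measurableSet_le_abs R)]
  refine ENNReal.add_lt_top.2 ⟨(hRF i).trans_lt ENNReal.one_lt_top, ?_⟩
  have hsub := compl_le_abs_subset_Icc R
  calc ∫⁻ ξ in {ξ : ℝ | R ≤ |ξ|}ᶜ, ‖F i ξ‖ₑ ≤ ∫⁻ ξ in Set.Icc (-R) R, ‖F i ξ‖ₑ :=
        lintegral_mono_set hsub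
    _ ≤ ∫⁻ _ in Set.Icc (-R) R, ENNReal.ofReal C := by
        refine lintegral_mono fun ξ => ?_
        rw [← ofReal_norm]
        exact ENNReal.ofReal_le_ofReal (hC i ξ)
    _ < ⊤ := by
        rw [setLIntegral_const]
        exact ENNReal.mul_lt_top ENNReal.ofReal_lt_top (by simp)

/-- Smoothing at a small scale changes the integrals of a family with uniform tails uniformly
little. -/
lemma HasUniformTails.exists_norm_integral_sub_le {ι : Type*} {F : ι → ℝ → ℂ}
    (h : HasUniformTails fun i ξ => ‖F i ξ‖ₑ) (hm : ∀ i, Measurable (F i)) {C : ℝ}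
    (hC0 : 0 < C) (hC : ∀ i ξ, ‖F i ξ‖ ≤ C) {ε : ℝ} (hε : 0 < ε) :
    ∃ δ₀ > 0, ∀ δ : ℝ, 0 < δ → δ < δ₀ → ∀ i,
      ‖(∫ ξ, (sincSq (δ * ξ) : ℂ) * F i ξ) - ∫ ξ, F i ξ‖ ≤ ε := by
  obtain ⟨R, hR, hRF⟩ := h (ENNReal.ofReal (ε / 2)) (by simpa using hε)
  -- The tolerance times `C` times the length `2 R` of the low-frequency window is `ε / 2`; the tail
  -- beyond `R` supplies the other half.
  have hg : ∀ᶠ t in 𝓝 (0 : ℝ), 1 - ε / (4 * R * C) < sincSq t := by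
    apply continuous_sincSq.continuousAt.eventually_const_lt
    rw [sincSq_zero]
    have : 0 < ε / (4 * R * C) := by positivity
    linarith
  obtain ⟨ρ, hρ, hball⟩ := Metric.eventually_nhds_iff.1 hg
  refine ⟨ρ / R, by positivity, fun δ hδ hδ2 i => ?_⟩
  have hint := h.integrable hm hC i
  have hint2 : Integrable fun ξ => (sincSq (δ * ξ) : ℂ) * F i ξ :=
    (integrable_sincSq_mul hδ).ofReal.mul_bdd (c := C) (hm i).aestronglyMeasurable
      (ae_of_all _ fun ξ => hC i ξ)
  rw [← integral_sub hint2 hint]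
  have hpt : ∀ ξ : ℝ, ‖(sincSq (δ * ξ) : ℂ) * F i ξ - F i ξ‖ = (1 - sincSq (δ * ξ)) * ‖F i ξ‖ := by
    intro ξ
    have : (sincSq (δ * ξ) : ℂ) * F i ξ - F i ξ = -(((1 - sincSq (δ * ξ) : ℝ) : ℂ) * F i ξ) := by
      push_cast
      ring
    rw [this, norm_neg, norm_mul, Complex.norm_real,
      Real.norm_of_nonneg (by linarith [sincSq_le_one (δ * ξ)])]
  have hsub := compl_le_abs_subset_Icc R
  have key : ‖∫ ξ, ((sincSq (δ * ξ) : ℂ) * F i ξ - F i ξ)‖ₑ ≤ ENNReal.ofReal ε := by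
    refine (enorm_integral_le_lintegral_enorm _).trans ?_
    rw [← lintegral_add_compl _ (measurableSet_le_abs R)]
    have hsplit : ENNReal.ofReal ε = ENNReal.ofReal (ε / 2) + ENNReal.ofReal (ε / 2) := by
      rw [← ENNReal.ofReal_add (by positivity) (by positivity), add_halves]
    rw [hsplit]
    refine add_le_add ((lintegral_mono fun ξ => ?_).trans (hRF i)) ?_
    · show _ ≤ ‖F i ξ‖ₑ
      rw [← ofReal_norm, ← ofReal_norm, hpt]
      apply ENNReal.ofReal_le_ofReal
      exact mul_le_of_le_one_left (norm_nonneg _) (by linarith [sincSq_nonneg (δ * ξ)])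
    · calc ∫⁻ ξ in {ξ : ℝ | R ≤ |ξ|}ᶜ, ‖(sincSq (δ * ξ) : ℂ) * F i ξ - F i ξ‖ₑ
          ≤ ∫⁻ _ in {ξ : ℝ | R ≤ |ξ|}ᶜ, ENNReal.ofReal (ε / (4 * R * C) * C) := by
            refine setLIntegral_mono' (measurableSet_le_abs R).compl fun ξ hξ => ?_
            rw [← ofReal_norm, hpt]
            apply ENNReal.ofReal_le_ofReal
            have h1 : |δ * ξ| < ρ := by
              rw [abs_mul, abs_of_pos hδ]
              have hξ' : |ξ| < R := not_le.1 hξ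
              rw [lt_div_iff₀ hR] at hδ2
              nlinarith [abs_nonneg ξ]
            have h2 := hball (y := δ * ξ) (by simpa using h1)
            exact mul_le_mul (by linarith) (hC i ξ) (norm_nonneg _) (by positivity)
        _ ≤ ∫⁻ _ in Set.Icc (-R) R, ENNReal.ofReal (ε / (4 * R * C) * C) :=
            lintegral_mono_set hsub
        _ = ENNReal.ofReal (ε / 2) := by
            rw [setLIntegral_const, Real.volume_Icc, ← ENNReal.ofReal_mul (by positivity)]
            congr 1
            field_simp
            ring
  rw [← ofReal_norm] at key
  exact (ENNReal.ofReal_le_ofReal_iff hε.le).1 key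

/-! ### Upper bound on sets without progressions. -/

lemma weight_le {z η : ℝ} (hz : |z| ≤ η) : 2 - 2 * Real.cos (Real.pi * z) ≤ (Real.pi * η) ^ 2 := by
  have h1 := Real.one_sub_sq_div_two_le_cos (x := Real.pi * z)
  have h2 : (Real.pi * z) ^ 2 ≤ (Real.pi * η) ^ 2 := by
    apply sq_le_sq'
    · nlinarith [Real.pi_pos, (abs_le.1 hz).1]
    · nlinarith [Real.pi_pos, (abs_le.1 hz).2]
  linarith

/-- On a compact set without progressions the weighted count is controlled by the weight close to
the diagonal. -/
lemma exists_weightedForm_le_of_no_progression {r : ℝ} {A : Set ℝ} (hA : IsCompact A)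
    (hno : ∀ x ∈ A, ∀ y ∈ A, x ≠ y → (1 - r) * x + r * y ∉ A) {μ : Measure ℝ}
    [IsProbabilityMeasure μ] (hμ : μ Aᶜ = 0) {η : ℝ} (hη : 0 < η) :
    ∃ δ₀ > 0, ∀ δ : ℝ, 0 < δ → δ < δ₀ →
      weightedForm r δ μ ≤ (Real.pi * η) ^ 2 * ∫ p, tentKernel δ
        ((1 - r) * p.1 + r * p.2.1 - p.2.2) ∂(μ.prod (μ.prod μ)) := by
  set S : Set (ℝ × ℝ × ℝ) := (A ×ˢ (A ×ˢ A)) ∩ {p | η ≤ |p.1 - p.2.1|} with hS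
  have hSc : IsCompact S :=
    (hA.prod (hA.prod hA)).inter_right (isClosed_le continuous_const (by fun_prop))
  -- Off the `η`-neighbourhood of the diagonal the defect is continuous and nonvanishing on a
  -- compact set, hence bounded below; a kernel narrower than this bound sees only near-diagonal
  -- triples.
  obtain ⟨m, hm, hmin⟩ : ∃ m > 0, ∀ p ∈ S, m ≤ |(1 - r) * p.1 + r * p.2.1 - p.2.2| := by
    rcases S.eq_empty_or_nonempty with h0 | hne
    · exact ⟨1, one_pos, by simp [h0]⟩
    · obtain ⟨p, hp, hpm⟩ := hSc.exists_isMinOn hne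
        (f := fun p => |(1 - r) * p.1 + r * p.2.1 - p.2.2|) (by fun_prop)
      refine ⟨_, abs_pos.2 fun h => ?_, fun q hq => hpm hq⟩
      refine hno p.1 hp.1.1 p.2.1 hp.1.2.1 (fun e => ?_) ?_
      · have : η ≤ |p.1 - p.2.1| := hp.2
        rw [e, sub_self, abs_zero] at this
        linarith
      · rw [sub_eq_zero.1 h]
        exact hp.1.2.2
  refine ⟨m, hm, fun δ hδ hδm => ?_⟩
  have hae : ∀ᵐ x ∂μ, x ∈ A := hμ
  have hae3 : ∀ᵐ p ∂(μ.prod (μ.prod μ)), p.1 ∈ A ∧ p.2.1 ∈ A ∧ p.2.2 ∈ A := by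
    have a1 := Measure.quasiMeasurePreserving_fst (μ := μ) (ν := μ.prod μ) |>.ae hae
    have a2 := Measure.quasiMeasurePreserving_snd (μ := μ) (ν := μ.prod μ) |>.ae
      (Measure.quasiMeasurePreserving_fst (μ := μ) (ν := μ) |>.ae hae)
    have a3 := Measure.quasiMeasurePreserving_snd (μ := μ) (ν := μ.prod μ) |>.ae
      (Measure.quasiMeasurePreserving_snd (μ := μ) (ν := μ) |>.ae hae)
    filter_upwards [a1, a2, a3] with p h1 h2 h3 using ⟨h1, h2, h3⟩
  have hK := continuous_tentKernel δ
  have hKi : Integrable (fun p : ℝ × ℝ × ℝ => tentKernel δ ((1 - r) * p.1 + r * p.2.1 - p.2.2))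
      (μ.prod (μ.prod μ)) := by
    refine (integrable_const δ⁻¹).mono' (by fun_prop) ?_
    filter_upwards with p
    rw [Real.norm_of_nonneg (tentKernel_nonneg hδ _)]
    exact tentKernel_le hδ _
  rw [← integral_const_mul]
  refine integral_mono_ae (integrable_tentKernel_mul_weight r hδ μ) (hKi.const_mul _) ?_
  filter_upwards [hae3] with p hp
  rw [mul_comm]
  rcases le_or_gt η |p.1 - p.2.1| with h | h
  · rw [tentKernel_of_le hδ (hδm.le.trans (hmin p ⟨⟨hp.1, hp.2.1, hp.2.2⟩, h⟩))]
    simp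
  · exact mul_le_mul_of_nonneg_right (weight_le h.le) (tentKernel_nonneg hδ _)

/-- A bound on the unweighted count that does not depend on `δ`, so that the near-diagonal
contribution vanishes as `η` tends to 0. -/
lemma integral_tentKernel_le_integral_freqForm (r : ℝ) {δ : ℝ} (hδ : 0 < δ) (μ : Measure ℝ)
    [IsProbabilityMeasure μ] (hint : Integrable (freqForm r 0 μ)) :
    ∫ p, tentKernel δ ((1 - r) * p.1 + r * p.2.1 - p.2.2) ∂(μ.prod (μ.prod μ))
      ≤ ∫ ξ, ‖freqForm r 0 μ ξ‖ := by
  have h := integral_tentKernel_eq r 0 hδ μ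
  simp_rw [zero_mul, echar_zero, mul_one, integral_complex_ofReal] at h
  refine (le_abs_self _).trans ?_
  rw [← Real.norm_eq_abs, ← Complex.norm_real, h]
  refine (norm_integral_le_integral_norm _).trans
    (integral_mono (integrable_sincSq_mul_freqForm r 0 hδ μ).norm hint.norm fun ξ => ?_)
  simp only [norm_mul, Complex.norm_real, Real.norm_of_nonneg (sincSq_nonneg _)]
  exact mul_le_of_le_one_left (norm_nonneg _) (sincSq_le_one _)

/-- A family of measures with uniform `L³` tails on compact sets without progressions has uniformly
small weighted counts. -/
lemma exists_weightedForm_le {ι : Type*} {r : ℝ} (hr0 : r ≠ 0) (hr1 : r ≠ 1) {A : ι → Set ℝ}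
    (hA : ∀ i, IsCompact (A i))
    (hno : ∀ i, ∀ x ∈ A i, ∀ y ∈ A i, x ≠ y → (1 - r) * x + r * y ∉ A i) {μ : ι → Measure ℝ}
    [∀ i, IsProbabilityMeasure (μ i)] (hμ : ∀ i, μ i (A i)ᶜ = 0)
    (h : HasUniformTails fun i ξ => ‖fourierTransform (μ i) ξ‖ₑ ^ 3) {ε : ℝ} (hε : 0 < ε) :
    ∃ δ₀ > 0, ∀ δ : ℝ, 0 < δ → δ < δ₀ → ∀ i, weightedForm r δ (μ i) ≤ ε := by
  have happrox := fun {ε : ℝ} (hε : 0 < ε) =>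
    (h.weightedFreq hr0 hr1).exists_norm_integral_sub_le
      (fun i => measurable_weightedFreq r (μ i)) four_pos
      (fun i ξ => norm_weightedFreq_le_four r (μ i) ξ) hε
  obtain ⟨δ₀, hδ₀, hmain⟩ := happrox (half_pos hε)
  refine ⟨δ₀, hδ₀, fun δ hδ hδ2 i => ?_⟩
  have hint : Integrable (freqForm r 0 (μ i)) := (h.freqForm hr0 hr1 0).integrable
    (fun i => measurable_freqForm r 0 (μ i)) (fun i ξ => norm_freqForm_le_one r 0 (μ i) ξ) i
  have h1 := hmain δ hδ hδ2 i
  rw [← weightedForm_eq r hδ] at h1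
  set C := ∫ ξ, ‖freqForm r 0 (μ i) ξ‖ with hC
  have hC0 : 0 ≤ C := integral_nonneg fun ξ => norm_nonneg _
  -- From here `C`, `η` and the auxiliary scale `δ'` may depend on `i`; only `δ₀` has to be uniform,
  -- and it is already fixed.
  set η : ℝ := Real.sqrt (ε / (4 * (C + 1))) / Real.pi with hη
  have hη0 : 0 < η := div_pos (Real.sqrt_pos.2 (by positivity)) Real.pi_pos
  have hη2 : (Real.pi * η) ^ 2 * C ≤ ε / 4 := by
    rw [hη, mul_div_cancel₀ _ Real.pi_ne_zero, Real.sq_sqrt (by positivity), div_mul_eq_mul_div,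
      div_le_iff₀ (by positivity)]
    nlinarith
  obtain ⟨δ₁, hδ₁, hsmall⟩ := exists_weightedForm_le_of_no_progression (hA i) (hno i) (hμ i) hη0
  obtain ⟨δ₂, hδ₂, hnear⟩ := happrox (show 0 < ε / 4 by positivity)
  set δ' := min δ₁ δ₂ / 2 with hδ'
  have hδ'0 : 0 < δ' := by positivity
  have hδ'1 : δ' < δ₁ := by
    have := min_le_left δ₁ δ₂
    linarith
  have hδ'2 : δ' < δ₂ := by
    have := min_le_right δ₁ δ₂
    linarith
  have h2 := hnear δ' hδ'0 hδ'2 i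
  rw [← weightedForm_eq r hδ'0] at h2
  have h3 : weightedForm r δ' (μ i) ≤ ε / 4 :=
    (hsmall δ' hδ'0 hδ'1).trans (le_trans (mul_le_mul_of_nonneg_left
      (integral_tentKernel_le_integral_freqForm r hδ'0 (μ i) hint) (by positivity)) hη2)
  have h4 : ‖(weightedForm r δ (μ i) : ℂ) - weightedForm r δ' (μ i)‖ ≤ ε / 2 + ε / 4 := by
    refine (norm_sub_le_norm_sub_add_norm_sub _ (∫ ξ, weightedFreq r (μ i) ξ) _).trans
      (add_le_add h1 ?_)
    rw [norm_sub_rev]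
    exact h2
  rw [← Complex.ofReal_sub, Complex.norm_real, Real.norm_eq_abs] at h4
  linarith [le_abs_self (weightedForm r δ (μ i) - weightedForm r δ' (μ i))]

/-! ### Weak limits. -/

lemma tendsto_fourierTransform {ν : ℕ → ProbabilityMeasure ℝ} {ν₀ : ProbabilityMeasure ℝ}
    (h : Tendsto ν atTop (𝓝 ν₀)) (ξ : ℝ) :
    Tendsto (fun n => fourierTransform (ν n) ξ) atTop (𝓝 (fourierTransform ν₀ ξ)) := by
  simp_rw [fourierTransform_eq_charFun]
  exact ProbabilityMeasure.tendsto_iff_tendsto_charFun.1 h _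

/-- At fixed `δ` the factor `sincSq (δ ξ)` is an integrable majorant up to the constant 4, so
pointwise convergence of the transforms suffices. -/
lemma tendsto_weightedForm (r : ℝ) {δ : ℝ} (hδ : 0 < δ) {ν : ℕ → ProbabilityMeasure ℝ}
    {ν₀ : ProbabilityMeasure ℝ} (h : Tendsto ν atTop (𝓝 ν₀)) :
    Tendsto (fun n => weightedForm r δ (ν n : Measure ℝ)) atTop
      (𝓝 (weightedForm r δ (ν₀ : Measure ℝ))) := by
  have hC : Tendsto (fun n => (weightedForm r δ (ν n : Measure ℝ) : ℂ)) atTop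
      (𝓝 (weightedForm r δ (ν₀ : Measure ℝ) : ℂ)) := by
    simp_rw [weightedForm_eq r hδ]
    refine tendsto_integral_of_dominated_convergence (fun ξ => sincSq (δ * ξ) * 4) ?_
      ((integrable_sincSq_mul hδ).mul_const 4) ?_ ?_
    · intro n
      have h1 := measurable_weightedFreq r (ν n : Measure ℝ)
      have h2 : Measurable sincSq := continuous_sincSq.measurable
      exact Measurable.aestronglyMeasurable (by fun_prop)
    · intro n
      refine ae_of_all _ fun ξ => ?_
      rw [norm_mul, Complex.norm_real, Real.norm_of_nonneg (sincSq_nonneg _)]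
      exact mul_le_mul_of_nonneg_left (norm_weightedFreq_le_four r _ ξ) (sincSq_nonneg _)
    · refine ae_of_all _ fun ξ => ?_
      have hf := fun u => ((tendsto_fourierTransform h (-((1 - r) * ξ + u))).mul
        ((tendsto_fourierTransform h (-(r * ξ - u))).mul (tendsto_fourierTransform h ξ)))
      exact ((((hf 0).const_mul 2).sub (hf (1 / 2))).sub (hf (-(1 / 2)))).const_mul _
  have := (Complex.continuous_re.tendsto _).comp hC
  simpa [Function.comp_def] using this

/-- Open intervals are what the portmanteau theorem controls. The bound passes to closed intervals
by enlargement, and a bounded set lies in a closed interval as long as its diameter, so `μ` is at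
most `Λ` times one-dimensional Hausdorff measure, which is Lebesgue measure. -/
lemma absolutelyContinuous_of_forall_Ioo_le {μ : Measure ℝ} {Λ : ℝ} (hΛ : 0 < Λ)
    (h : ∀ a b : ℝ, a < b → μ (Set.Ioo a b) ≤ ENNReal.ofReal (Λ * (b - a))) : μ ≪ volume := by
  have hIcc : ∀ a b : ℝ, a ≤ b → μ (Set.Icc a b) ≤ ENNReal.ofReal (Λ * (b - a)) := by
    intro a b hab
    have hlim : Tendsto (fun t : ℝ => ENNReal.ofReal (Λ * (b + t - (a - t)))) (𝓝[>] 0)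
        (𝓝 (ENNReal.ofReal (Λ * (b - a)))) := by
      have : Continuous fun t : ℝ => ENNReal.ofReal (Λ * (b + t - (a - t))) :=
        ENNReal.continuous_ofReal.comp (by fun_prop)
      have h0 := this.tendsto 0
      simp only [add_zero, sub_zero] at h0
      exact h0.mono_left nhdsWithin_le_nhds
    refine ge_of_tendsto hlim ?_
    filter_upwards [self_mem_nhdsWithin] with t ht
    have ht' : 0 < t := ht
    refine (measure_mono ?_).trans (h (a - t) (b + t) (by linarith))
    exact Set.Icc_subset_Ioo (by linarith) (by linarith)
  have hΛ' : ENNReal.ofReal Λ ≠ 0 := by simpa using hΛ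
  have hle : (ENNReal.ofReal Λ)⁻¹ • μ ≤ Measure.hausdorffMeasure 1 := by
    refine Measure.le_hausdorffMeasure 1 _ 1 one_pos fun s hs => ?_
    rcases s.eq_empty_or_nonempty with rfl | hne
    · simp
    have hb : Bornology.IsBounded s :=
      Metric.isBounded_iff_ediam_ne_top.2 (hs.trans_lt ENNReal.one_lt_top).ne
    rw [Real.ediam_eq hb, ENNReal.rpow_one, Measure.smul_apply, smul_eq_mul,
      ENNReal.inv_mul_le_iff hΛ' ENNReal.ofReal_ne_top, ← ENNReal.ofReal_mul hΛ.le]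
    have hsub := hb.subset_Icc_sInf_sSup
    refine (measure_mono hsub).trans (hIcc _ _ ?_)
    obtain ⟨x, hx⟩ := hne
    exact (hsub hx).1.trans (hsub hx).2
  rw [hausdorffMeasure_real] at hle
  intro s hs
  have h0 := Measure.le_iff'.1 hle s
  rw [hs, Measure.smul_apply, smul_eq_mul, nonpos_iff_eq_zero, mul_eq_zero] at h0
  exact h0.resolve_left (by simp)

lemma exists_tendsto_subseq_of_Icc (ν : ℕ → ProbabilityMeasure ℝ)
    (h : ∀ n, (ν n : Measure ℝ) (Set.Icc 0 1) = 1) :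
    ∃ (ν₀ : ProbabilityMeasure ℝ) (φ : ℕ → ℕ), StrictMono φ ∧ Tendsto (ν ∘ φ) atTop (𝓝 ν₀) := by
  have htight : IsTightMeasureSet
      {((μ : ProbabilityMeasure ℝ) : Measure ℝ) | μ ∈ Set.range ν} := by
    rw [isTightMeasureSet_iff_exists_isCompact_measure_compl_le]
    intro ε _
    refine ⟨Set.Icc 0 1, isCompact_Icc, ?_⟩
    rintro _ ⟨_, ⟨n, rfl⟩, rfl⟩
    rw [(prob_compl_eq_zero_iff measurableSet_Icc).2 (h n)]
    exact zero_le
  obtain ⟨ν₀, -, φ, hφ, hlim⟩ := (isCompact_closure_of_isTightMeasureSet htight).tendsto_subseq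
    (x := ν) fun n => subset_closure ⟨n, rfl⟩
  exact ⟨ν₀, φ, hφ, hlim⟩

lemma absolutelyContinuous_of_tendsto_of_isFrostman {ν : ℕ → ProbabilityMeasure ℝ}
    {ν₀ : ProbabilityMeasure ℝ} (h : Tendsto ν atTop (𝓝 ν₀)) {Λ : ℝ} (hΛ : 1 ≤ Λ) {β ε : ℕ → ℝ}
    (hfr : ∀ n, IsFrostman (ν n) Λ (β n)) (hβ : ∀ n, 1 - ε n ≤ β n)
    (hε : Tendsto ε atTop (𝓝 0)) : (ν₀ : Measure ℝ) ≪ volume := by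
  refine absolutelyContinuous_of_forall_Ioo_le (zero_lt_one.trans_le hΛ) fun a b hab => ?_
  -- Lowering the Frostman exponent needs length at most 1; for longer intervals total mass 1 and `Λ
  -- ≥ 1` suffice.
  rcases le_or_gt 1 (b - a) with h1 | h1
  · refine prob_le_one.trans ?_
    rw [← ENNReal.ofReal_one]
    apply ENNReal.ofReal_le_ofReal
    nlinarith
  refine (ProbabilityMeasure.le_liminf_measure_open_of_tendsto h isOpen_Ioo).trans ?_
  have hlim : Tendsto (fun n => ENNReal.ofReal (Λ * (b - a) ^ (1 - ε n))) atTop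
      (𝓝 (ENNReal.ofReal (Λ * (b - a)))) := by
    refine ENNReal.tendsto_ofReal ?_
    have h2 : Tendsto (fun n => 1 - ε n) atTop (𝓝 1) := by simpa using hε.const_sub 1
    have h3 := (Real.continuousAt_const_rpow (a := b - a) (b := 1)
      (by linarith)).tendsto.comp h2
    rw [Real.rpow_one] at h3
    exact h3.const_mul Λ
  rw [← hlim.liminf_eq]
  refine liminf_le_liminf (Eventually.of_forall fun n => ?_)
  exact (measure_mono Set.Ioo_subset_Icc_self).trans
    ((hfr n).measure_Icc_le (by linarith) (hβ n) hab h1.le)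

/-! ### The compactness argument and uniformity over the rationals. -/

/-- Sets carrying a measure with small Frostman deficiency and `L⁴` decay of the Fourier transform
contain an affine image of `{0, 1, r}`. -/
theorem exists_eps_forall_exists_progression {r Λ c₀ K : ℝ} {ω : ℕ → ℝ} (hr0 : r ≠ 0)
    (hr1 : r ≠ 1) (hc₀ : 0 < c₀) (hω : Tendsto ω atTop (𝓝 0)) :
    ∃ ε₀ : ℝ, 0 < ε₀ ∧ ∀ (A : Set ℝ) (β : ℝ) (μ : Measure ℝ), IsCompact A →
      A ⊆ Set.Icc 0 1 → IsProbabilityOn μ A → 1 - ε₀ < β → IsFrostman μ Λ β →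
      IsFourierUniform μ K ω c₀ → ∃ x ∈ A, ∃ y ∈ A, x ≠ y ∧ (1 - r) * x + r * y ∈ A := by
  by_contra! hcon
  -- Capping the deficiencies at `e` puts every `μ n` within reach of the `L³` tail bound, not just
  -- those with large `n`.
  set e : ℝ := min (c₀ / 2) 1 with he
  have he0 : 0 < e := lt_min (by positivity) one_pos
  set ε : ℕ → ℝ := fun n => e / (n + 1) with hε
  have hε0 : ∀ n, 0 < ε n := fun n => by positivity
  have hεe : ∀ n, ε n ≤ e := fun n =>
    div_le_self he0.le (by linarith [Nat.cast_nonneg (α := ℝ) n])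
  have hεlim : Tendsto ε atTop (𝓝 0) := by
    have := tendsto_one_div_add_atTop_nhds_zero_nat (𝕜 := ℝ) |>.const_mul e
    simpa [hε, div_eq_mul_inv] using this
  choose A β μ hA hA1 hμ hβ hfr hfu hno using fun n => hcon (ε n) (hε0 n)
  have hprob : ∀ n, IsProbabilityMeasure (μ n) := fun n => (hμ n).1
  have hIcc : ∀ n, μ n (Set.Icc 0 1) = 1 := fun n => (hμ n).measure_Icc (hA1 n)
  have hΛ : 1 ≤ Λ := (hfr 0).one_le (hIcc 0)
  have htails : HasUniformTails fun n ξ => ‖fourierTransform (μ n) ξ‖ₑ ^ 3 := by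
    intro η hη
    obtain ⟨R, hR, hRμ⟩ := exists_radius_lintegral_pow_three_le (Λ := Λ) (K := K) hc₀ hω hη
    exact ⟨R, hR, fun n => hRμ (μ n) (β n) (hprob n) (by linarith)
      (by linarith [hβ n, hεe n]) (hfr n) (hfu n)⟩
  set ν : ℕ → ProbabilityMeasure ℝ := fun n => ⟨μ n, hprob n⟩ with hν
  obtain ⟨ν₀, φ, hφ, hlim⟩ := exists_tendsto_subseq_of_Icc ν hIcc
  have hac : (ν₀ : Measure ℝ) ≪ volume :=
    absolutelyContinuous_of_tendsto_of_isFrostman hlim hΛ (β := β ∘ φ) (ε := ε ∘ φ)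
      (fun n => hfr (φ n)) (fun n => (hβ (φ n)).le) (hεlim.comp hφ.tendsto_atTop)
  obtain ⟨κ, hκ, δ₀, hδ₀, hlow⟩ := exists_pos_le_weightedForm r hac
  obtain ⟨δ₁, hδ₁, hup⟩ := exists_weightedForm_le hr0 hr1 hA hno (fun n => (hμ n).2) htails
    (half_pos hκ)
  set δ := min δ₀ δ₁ / 2 with hδdef
  have hδ : 0 < δ := by positivity
  have h1 := hlow δ hδ (by linarith [min_le_left δ₀ δ₁])
  have h2 : weightedForm r δ (ν₀ : Measure ℝ) ≤ κ / 2 :=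
    le_of_tendsto (tendsto_weightedForm r hδ hlim) (Eventually.of_forall fun n =>
      hup δ hδ (by linarith [min_le_right δ₀ δ₁]) (φ n))
  linarith

lemma finite_rationalsOfHeight (M : ℕ) : (rationalsOfHeight M).Finite := by
  have hfin : (Set.Icc (-(M * M : ℤ)) (M * M) ×ˢ Set.Iic M : Set (ℤ × ℕ)).Finite :=
    (Set.finite_Icc _ _).prod (Set.finite_Iic _)
  refine Set.Finite.of_injOn (f := fun θ : ℚ => (θ.num, θ.den)) ?_ ?_ hfin
  · rintro θ ⟨hden, habs⟩
    refine ⟨abs_le.1 ?_, hden⟩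
    have h1 : |(θ.num : ℚ)| = |θ| * θ.den := by
      rw [← Rat.mul_den_eq_num, abs_mul, Nat.abs_cast]
    have h2 : |(θ.num : ℚ)| ≤ M * M := by
      rw [h1]
      have : (θ.den : ℚ) ≤ M := by exact_mod_cast hden
      gcongr
    exact_mod_cast h2
  · intro θ _ θ' _ h
    simp only [Prod.mk.injEq] at h
    exact Rat.ext h.1 h.2

/-- The step `t = (x - y) / θ₁` sends `x - θ₁ t` to `y`, and then `x - θ₂ t` is the required affine
combination. -/
lemma containsProgression_of_ne {A : Set ℝ} {θ₁ θ₂ : ℚ} (h1 : θ₁ ≠ 0) {x y : ℝ} (hx : x ∈ A)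
    (hy : y ∈ A) (hxy : x ≠ y)
    (hz : (1 - (θ₂ / θ₁ : ℝ)) * x + (θ₂ / θ₁ : ℝ) * y ∈ A) : ContainsProgression A θ₁ θ₂ := by
  have h1' : (θ₁ : ℝ) ≠ 0 := by exact_mod_cast h1
  refine ⟨x, (x - y) / θ₁, div_ne_zero (sub_ne_zero.2 hxy) h1', ?_⟩
  have e1 : x - (θ₁ : ℝ) * ((x - y) / θ₁) = y := by
    field_simp
    ring
  have e2 : x - (θ₂ : ℝ) * ((x - y) / θ₁) = (1 - (θ₂ / θ₁ : ℝ)) * x + (θ₂ / θ₁ : ℝ) * y := by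
    field_simp
    ring
  rw [e1, e2]
  rintro z (rfl | rfl | rfl) <;> assumption

lemma ContainsProgression.symm {A : Set ℝ} {θ₁ θ₂ : ℚ} (h : ContainsProgression A θ₁ θ₂) :
    ContainsProgression A θ₂ θ₁ := by
  obtain ⟨x, t, ht, hs⟩ := h
  refine ⟨x, t, ht, ?_⟩
  rwa [Set.pair_comm]

/-- The degenerate progressions only need two distinct points. -/
lemma containsProgression_of_degenerate {A : Set ℝ} (hA : A.Nontrivial) {θ₁ θ₂ : ℚ}
    (h : θ₁ = 0 ∨ θ₂ = 0 ∨ θ₁ = θ₂) : ContainsProgression A θ₁ θ₂ := by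
  obtain ⟨x, hx, y, hy, hxy⟩ := hA
  rcases eq_or_ne θ₁ 0 with h1 | h1
  · rcases eq_or_ne θ₂ 0 with h2 | h2
    · exact ⟨x, 1, one_ne_zero, by simp [h1, h2, hx]⟩
    · exact (containsProgression_of_ne h2 hx hy hxy (by simpa [h1] using hx)).symm
  · rcases h.resolve_left h1 with h2 | h2
    · exact containsProgression_of_ne h1 hx hy hxy (by simpa [h2] using hx)
    · refine containsProgression_of_ne h1 hx hy hxy ?_
      have h1' : (θ₁ : ℝ) ≠ 0 := by exact_mod_cast h1
      simpa [← h2, div_self h1'] using hy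

lemma exists_eps_containsProgression {Λ c₀ K : ℝ} {ω : ℕ → ℝ} (hc₀ : 0 < c₀)
    (hω : Tendsto ω atTop (𝓝 0)) (θ₁ θ₂ : ℚ) :
    ∃ ε₀ : ℝ, 0 < ε₀ ∧ ∀ (A : Set ℝ) (β : ℝ) (μ : Measure ℝ), IsCompact A →
      A ⊆ Set.Icc 0 1 → A.Nontrivial → IsProbabilityOn μ A → 1 - ε₀ < β → IsFrostman μ Λ β →
      IsFourierUniform μ K ω c₀ → ContainsProgression A θ₁ θ₂ := by
  by_cases hdeg : θ₁ = 0 ∨ θ₂ = 0 ∨ θ₁ = θ₂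
  · exact ⟨1, one_pos, fun A β μ _ _ hnt _ _ _ _ => containsProgression_of_degenerate hnt hdeg⟩
  push Not at hdeg
  obtain ⟨h1, h2, h12⟩ := hdeg
  have h1' : (θ₁ : ℝ) ≠ 0 := by exact_mod_cast h1
  have h2' : (θ₂ : ℝ) ≠ 0 := by exact_mod_cast h2
  obtain ⟨ε₀, hε₀, H⟩ := exists_eps_forall_exists_progression (r := (θ₂ / θ₁ : ℝ)) (Λ := Λ)
    (K := K) (div_ne_zero h2' h1')
    (fun h => h12 (by rw [div_eq_one_iff_eq h1'] at h; exact_mod_cast h.symm)) hc₀ hω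
  refine ⟨ε₀, hε₀, fun A β μ hA hA1 _ hμ hβ hfr hfu => ?_⟩
  obtain ⟨x, hx, y, hy, hxy, hz⟩ := H A β μ hA hA1 hμ hβ hfr hfu
  exact containsProgression_of_ne h1 hx hy hxy hz

lemma exists_eps_forall_rationalsOfHeight {Λ c₀ K : ℝ} {ω : ℕ → ℝ} (hc₀ : 0 < c₀)
    (hω : Tendsto ω atTop (𝓝 0)) (M : ℕ) :
    ∃ ε₀ : ℝ, 0 < ε₀ ∧ ∀ (A : Set ℝ) (β : ℝ) (μ : Measure ℝ), IsCompact A →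
      A ⊆ Set.Icc 0 1 → A.Nontrivial → IsProbabilityOn μ A → 1 - ε₀ < β → IsFrostman μ Λ β →
      IsFourierUniform μ K ω c₀ →
      ∀ θ₁ ∈ rationalsOfHeight M, ∀ θ₂ ∈ rationalsOfHeight M, ContainsProgression A θ₁ θ₂ := by
  choose ε hε H using fun p : ℚ × ℚ =>
    exists_eps_containsProgression (Λ := Λ) (K := K) hc₀ hω p.1 p.2
  have hev : ∀ᶠ t : ℝ in 𝓝[>] 0, ∀ p ∈ rationalsOfHeight M ×ˢ rationalsOfHeight M, t < ε p := by
    rw [eventually_all_finite ((finite_rationalsOfHeight M).prod (finite_rationalsOfHeight M))]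
    intro p _
    exact (eventually_lt_nhds (hε p)).filter_mono nhdsWithin_le_nhds
  obtain ⟨t, ht, ht0⟩ := (hev.and self_mem_nhdsWithin).exists
  refine ⟨t, ht0, fun A β μ hA hA1 hnt hμ hβ hfr hfu θ₁ h1 θ₂ h2 => ?_⟩
  exact H (θ₁, θ₂) A β μ hA hA1 hnt hμ (by linarith [ht (θ₁, θ₂) ⟨h1, h2⟩]) hfr hfu

lemma nontrivial_of_dimH_pos {A : Set ℝ} {s : ℝ≥0} (h : dimH A = s) (hs : 0 < (s : ℝ)) :
    A.Nontrivial := by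
  rw [← Set.not_subsingleton_iff]
  intro hsub
  rw [dimH_subsingleton hsub] at h
  have : s = 0 := by exact_mod_cast h.symm
  simp [this] at hs

lemma coe_le_one_of_dimH_eq {A : Set ℝ} {s : ℝ≥0} (h : dimH A = s) : (s : ℝ) ≤ 1 := by
  have h1 : dimH A ≤ 1 := by
    refine (dimH_mono (Set.subset_univ A)).trans ?_
    rw [Real.dimH_univ]
  rw [h] at h1
  exact_mod_cast h1

/-! ### Pointwise Fourier decay implies uniformity. -/

lemma volume_annulus_le (l : ℕ) :
    volume (annulus l) ≤ ENNReal.ofReal ((2 : ℝ) ^ ((l : ℝ) + 2)) := by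
  have hsub : annulus l ⊆ Set.Icc (-(2 : ℝ) ^ ((l : ℤ) + 1)) ((2 : ℝ) ^ ((l : ℤ) + 1)) :=
    fun ξ hξ => abs_le.1 hξ.2
  refine (measure_mono hsub).trans ?_
  rw [Real.volume_Icc]
  apply ENNReal.ofReal_le_ofReal
  rw [← Real.rpow_intCast]
  push_cast
  rw [show (l : ℝ) + 2 = (l + 1) + 1 by ring, Real.rpow_add_one two_ne_zero ((l : ℝ) + 1)]
  linarith

/-- The supremum on the annulus times the fourth root of its measure has exponent `(l + 2) / 4 - (l
- 1) α / 2`. Its slope in `l` is `-(2 α - 1) / 4`, and its constant term `α / 2 + 1 / 2` goes into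
the new `K`. -/
lemma HasFourierDecay.isFourierUniform {μ : Measure ℝ} {K α : ℝ} (hα : 0 ≤ α)
    (h : HasFourierDecay μ K α) :
    IsFourierUniform μ (|K| * (2 : ℝ) ^ (α / 2 + 1 / 2)) (fun _ => 0) ((2 * α - 1) / 4) := by
  intro l _
  set B : ℝ := |K| * (2 : ℝ) ^ (((l : ℝ) - 1) * (-α / 2)) with hB
  have hbound : ∀ ξ ∈ annulus l, ‖fourierTransform μ ξ‖ ≤ B := by
    intro ξ hξ
    have h1 : (2 : ℝ) ^ ((l : ℝ) - 1) ≤ |ξ| := by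
      have := hξ.1
      rw [← Real.rpow_intCast] at this
      push_cast at this
      exact this
    calc ‖fourierTransform μ ξ‖ ≤ K * (1 + |ξ|) ^ (-α / 2) := h ξ
      _ ≤ |K| * (1 + |ξ|) ^ (-α / 2) := by
          gcongr
          exact le_abs_self K
      _ ≤ |K| * ((2 : ℝ) ^ ((l : ℝ) - 1)) ^ (-α / 2) := by
          refine mul_le_mul_of_nonneg_left ?_ (abs_nonneg K)
          exact Real.rpow_le_rpow_of_nonpos (by positivity) (by linarith) (by linarith)
      _ = B := by rw [hB, Real.rpow_mul (by norm_num)]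
  rw [eLpNorm_indicator_eq_eLpNorm_restrict (measurableSet_annulus l)]
  have hle := eLpNorm_le_of_ae_bound (p := 4) (μ := volume.restrict (annulus l)) (C := B)
    ((ae_restrict_iff' (measurableSet_annulus l)).2 (ae_of_all _ hbound))
  refine hle.trans ?_
  rw [Measure.restrict_apply_univ]
  calc volume (annulus l) ^ (4 : ℝ≥0∞).toReal⁻¹ * ENNReal.ofReal B
      ≤ ENNReal.ofReal ((2 : ℝ) ^ ((l : ℝ) + 2)) ^ (4 : ℝ≥0∞).toReal⁻¹ * ENNReal.ofReal B := by
        gcongr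
        exact volume_annulus_le l
    _ = ENNReal.ofReal (((2 : ℝ) ^ ((l : ℝ) + 2)) ^ (1 / 4 : ℝ) * B) := by
        have e4 : (4 : ℝ≥0∞).toReal⁻¹ = 1 / 4 := by norm_num
        rw [ENNReal.ofReal_mul (p := ((2 : ℝ) ^ ((l : ℝ) + 2)) ^ (1 / 4 : ℝ)) (q := B)
          (by positivity), e4, ENNReal.ofReal_rpow_of_nonneg (by positivity) (by positivity)]
    _ = _ := by
        congr 1
        rw [hB, ← Real.rpow_mul (by norm_num), mul_left_comm, ← Real.rpow_add two_pos,
          mul_assoc, ← Real.rpow_add two_pos]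
        congr 2
        ring

end Roth

end

theorem theorem1p5 :
    (∀ (M : ℕ) (Λ c₀ K : ℝ) (ω : ℕ → ℝ), Tendsto ω atTop (𝓝 0) →
      ∃ ε₀ : ℝ, 0 < ε₀ ∧
        ∀ (A : Set ℝ) (s : ℝ≥0) (β : ℝ) (μ : Measure ℝ),
          IsCompact A → A ⊆ Set.Icc (0 : ℝ) 1 →
          dimH A = (s : ℝ≥0∞) → 1 - ε₀ < (s : ℝ) →
          Roth.IsProbabilityOn μ A →
          1 - ε₀ < β → Roth.IsFrostman μ Λ β →
          Roth.IsFourierUniform μ K ω c₀ → c₀ > (1 - (s : ℝ)) / 4 →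
          ∀ θ₁ ∈ Roth.rationalsOfHeight M, ∀ θ₂ ∈ Roth.rationalsOfHeight M,
            Roth.ContainsProgression A θ₁ θ₂) ∧
    (∀ (M : ℕ) (Λ α K : ℝ), 1 / 2 < α →
      ∃ ε₀ : ℝ, 0 < ε₀ ∧
        ∀ (A : Set ℝ) (s : ℝ≥0) (β : ℝ) (μ : Measure ℝ),
          IsCompact A → A ⊆ Set.Icc (0 : ℝ) 1 →
          dimH A = (s : ℝ≥0∞) → 1 - ε₀ < (s : ℝ) →
          Roth.IsProbabilityOn μ A →
          1 - ε₀ < β → Roth.IsFrostman μ Λ β →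
          Roth.HasFourierDecay μ K α →
          ∀ θ₁ ∈ Roth.rationalsOfHeight M, ∀ θ₂ ∈ Roth.rationalsOfHeight M,
            Roth.ContainsProgression A θ₁ θ₂) := by
  refine ⟨fun M Λ c₀ K ω hω => ?_, fun M Λ α K hα => ?_⟩
  -- Subsets of the line have dimension at most 1, so `c₀ > (1 - s) / 4` forces `c₀ > 0` and the
  -- first case is vacuous.
  · rcases le_or_gt c₀ 0 with hc | hc
    · refine ⟨1, one_pos, fun A s β μ _ _ hs _ _ _ _ _ hcs => ?_⟩
      linarith [Roth.coe_le_one_of_dimH_eq hs]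
    · obtain ⟨ε₀, hε₀, H⟩ :=
        Roth.exists_eps_forall_rationalsOfHeight (Λ := Λ) (K := K) hc hω M
      -- The cap at 1 makes the dimension positive, so `A` has the two distinct points that the
      -- degenerate progressions need.
      refine ⟨min ε₀ 1, lt_min hε₀ one_pos, fun A s β μ hA hA1 hs hs1 hμ hβ hfr hfu _ => ?_⟩
      exact H A β μ hA hA1
        (Roth.nontrivial_of_dimH_pos hs (by linarith [min_le_right ε₀ 1])) hμ
        (by linarith [min_le_left ε₀ 1]) hfr hfu
  · obtain ⟨ε₀, hε₀, H⟩ := Roth.exists_eps_forall_rationalsOfHeight (Λ := Λ)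
      (K := |K| * (2 : ℝ) ^ (α / 2 + 1 / 2)) (c₀ := (2 * α - 1) / 4) (ω := fun _ => 0)
      (by linarith) tendsto_const_nhds M
    refine ⟨min ε₀ 1, lt_min hε₀ one_pos, fun A s β μ hA hA1 hs hs1 hμ hβ hfr hfd => ?_⟩
    exact H A β μ hA hA1
      (Roth.nontrivial_of_dimH_pos hs (by linarith [min_le_right ε₀ 1])) hμ
      (by linarith [min_le_left ε₀ 1]) hfr (hfd.isFourierUniform (by linarith))
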